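/- Conventions. A non-commutative probability space $(\mathcal A,\varphi)$ is a unital complex algebra with a linear functional $\varphi$ such that $\varphi(1)=1$; it is a $*$-probability space if $\mathcal A$ is a $*$-algebra and $\varphi(a^*a)\ge 0$ for all $a$. Variables $(x_i)_{i\in I}$ are free if $\varphi(a_1\cdots a_k)=0$ whenever $k\ge 1$, $a_j$ lies in the unital algebra generated by $x_{i(j)}$, $\varphi(a_j)=0$ for all $j$, and $i(j)\ne i(j+1)$ for all $1\le j<k$. A variable $s$ has the standard semicircular distribution if $\varphi(s^{2n})=\frac1{n+1}\binom{2n}{n}$ and $\varphi(s^{2n+1})=0$ for all $n\ge 0$; it is a standard semicircular element if moreover it is a self-adjoint element of a $*$-probability space. A random $N\times N$ matrix $A=(a_{ij})$ is $\mathrm{GUE}(N)$ if $A=A^*$ and its entries form a centered complex Gaussian family with $\mathbb E[a_{ij}a_{kl}]=\frac1N\delta_{il}\delta_{jk}$; $\mathrm{GUE}(N)$ matrices $A^{(1)},\dots,A^{(t)}$ are independent if their upper triangular entries, taken all together, are independent. Write $\operatorname{tr}$ for the normalized trace. A family of random $N\times N$ matrices converges in distribution to a family in a non-commutative probability space if every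 joint moment with respect to $\mathbb E\circ\operatorname{tr}$ exists and converges, as $N\to\infty$, to the corresponding joint moment. Let $NC_2(m)$ be the set of non-crossing pair partitions of $[m]=\{1,\dots,m\}$. Identify $\pi\in NC_2(m)$ with the permutation whose orbits are its blocks, let $\gamma=(1\,2\,\cdots\,m)$ and $(\pi\gamma)(n)=\pi(\gamma(n))$, and for a permutation $\sigma$ of $[m]$ put $$\varphi_\sigma(a_1,\dots,a_m)=\prod_{c\text{ orbit of }\sigma}\varphi\bigl(a_{i_c}a_{\sigma(i_c)}a_{\sigma^2(i_c)}\cdots a_{\sigma^{|c|-1}(i_c)}\bigr),\qquad i_c=\min c .$$ For $p:[m]\to[t]$, $\pi\le\ker p$ means that $p$ is constant on the blocks of $\pi$. The Kreweras complement $K(\pi)$ is the largest non-crossing partition $\sigma$ of $\{\bar1,\dots,\bar m\}\cong[m]$ such that $\pi\cup\sigma$ is a non-crossing partition of $1<\bar1<2<\bar2<\dots<m<\bar m$. Theorem. For each $N\ge 1$ let $A_N^{(1)},\dots,A_N^{(t)}$ be independent $\mathrm{GUE}(N)$ matrices and let $D_N\in M_N(\mathbb C)$ be deterministic. Assume that $D_N$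 converges in distribution to a variable $d$ of some non-commutative probability space $(\mathcal A,\varphi)$, i.e. $\operatorname{tr}(D_N^k)\to\varphi(d^k)$ for all $k\ge1$. Then: (1) For all $m$, $q:[m]\to\mathbb N_0$ and $p:[m]\to[t]$, the expectations below exist and $$\lim_{N\to\infty}\mathbb E\bigl[\operatorname{tr}\bigl(A_N^{(p(1))}D_N^{q(1)}\cdots A_N^{(p(m))}D_N^{q(m)}\bigr)\bigr]=\sum_{\substack{\pi\in NC_2(m)\\ \pi\le\ker p}}\varphi_{\pi\gamma}\bigl(d^{q(1)},\dots,d^{q(m)}\bigr),$$ and for each of these $\pi$ the partition of $[m]$ into the orbits of $\pi\gamma$ is the Kreweras complement $K(\pi)$. (2) There are a $*$-probability space with free standard semicircular elements $s_1,\dots,s_t$ such that $(A_N^{(1)},\dots,A_N^{(t)})$ converges in distribution to $(s_1,\dots,s_t)$, a non-commutative probability space to which it maps by a unital algebra homomorphism preserving the functionals, and in the latter a variable $d'$ with the same moments as $d$, such that (the images of) $s_1,\dots,s_t$ and $d'$ are free and $$(A_N^{(1)},\dots,A_N^{(t)},D_N)\longrightarrow(s_1,\dots,s_t,d')\quad\text{in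 distribution.}$$ (3) Moreover, if $s_1,\dots,s_t$ are any variables of a non-commutative probability space that have the standard semicircular distribution, then $(A_N^{(1)},\dots,A_N^{(t)})$ converges in distribution to $(s_1,\dots,s_t)$ whenever $s_1,\dots,s_t$ are free, and $(A_N^{(1)},\dots,A_N^{(t)},D_N)$ converges in distribution to $(s_1,\dots,s_t,d')$ for every $d'$ in that space which has the same moments as $d$ and for which $s_1,\dots,s_t,d'$ are free. -/

import Mathlib

open MeasureTheory ProbabilityTheory Filter Topology

universe u v w

/-! ### Non-commutative probability spaces -/

/-- A non-commutative probability space: a unital associative complex algebra with a unital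
linear functional `φ`. -/
structure NCProbSpace where
  carrier : Type u
  [ring : Ring carrier]
  [algebra : Algebra ℂ carrier]
  φ : carrier →ₗ[ℂ] ℂ
  φ_one : φ 1 = 1

attribute [instance] NCProbSpace.ring NCProbSpace.algebra

instance : CoeSort NCProbSpace.{u} (Type u) := ⟨NCProbSpace.carrier⟩

/-- A `*`-probability space: a non-commutative probability space whose algebra is a complex
`*`-algebra and whose functional is positive. -/
structure StarProbSpace extends NCProbSpace.{u} where
  [starRing : StarRing carrier]
  [starModule : StarModule ℂ carrier]
  φ_nonneg : ∀ a : carrier, 0 ≤ (φ (star a * a)).re ∧ (φ (star a * a)).im = 0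

attribute [instance] StarProbSpace.starRing StarProbSpace.starModule

/-- Freeness of a family of unital subalgebras: alternating products of centered elements are
centered. -/
def FreeSubalgebras (𝒜 : NCProbSpace.{u}) {ι : Type*} (S : ι → Subalgebra ℂ 𝒜) : Prop :=
  ∀ (k : ℕ), 1 ≤ k → ∀ (i : Fin k → ι) (a : Fin k → 𝒜),
    (∀ j, a j ∈ S (i j)) →
    (∀ j j' : Fin k, (j : ℕ) + 1 = j' → i j ≠ i j') →
    (∀ j, 𝒜.φ (a j) = 0) →
    𝒜.φ (List.ofFn a).prod = 0

/-- Freeness of a family of random variables: the generated unital subalgebras are free. -/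
def FreeVariables (𝒜 : NCProbSpace.{u}) {ι : Type*} (x : ι → 𝒜) : Prop :=
  FreeSubalgebras 𝒜 fun i => Algebra.adjoin ℂ {x i}

/-- The moments of `s` are those of the standard semicircular distribution (odd moments vanish,
the moment of order `2 n` is the `n`-th Catalan number). -/
def HasStandardSemicircularLaw (𝒜 : NCProbSpace.{u}) (s : 𝒜) : Prop :=
  ∀ n : ℕ, 𝒜.φ (s ^ (2 * n)) = (catalan n : ℂ) ∧ 𝒜.φ (s ^ (2 * n + 1)) = 0

/-- A standard semicircular element of a `*`-probability space. -/
def IsStandardSemicircular (𝒜 : StarProbSpace.{u}) (s : 𝒜.carrier) : Prop :=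
  IsSelfAdjoint s ∧ HasStandardSemicircularLaw 𝒜.toNCProbSpace s

/-! ### Random matrices -/

/-- The normalized trace. -/
noncomputable def normTrace {N : ℕ} (M : Matrix (Fin N) (Fin N) ℂ) : ℂ :=
  M.trace / (N : ℂ)

/-- `A` is a `GUE(N)` random matrix: it is self-adjoint, and its entries form a centered complex
Gaussian family (all real and imaginary parts are jointly Gaussian) with covariance
`E[a i j * a k l] = δ i l * δ j k / N`. -/
structure IsGUE {Ω : Type*} [MeasurableSpace Ω] (P : Measure Ω) {N : ℕ}
    (A : Ω → Matrix (Fin N) (Fin N) ℂ) : Prop where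
  selfAdjoint : ∀ᵐ ω ∂P, (A ω).IsHermitian
  gaussian : IsGaussianProcess (fun (ij : Fin N × Fin N) ω => A ω ij.1 ij.2) P
  centered : ∀ i j, ∫ ω, A ω i j ∂P = 0
  covariance : ∀ i j k l,
    ∫ ω, A ω i j * A ω k l ∂P = if i = l ∧ j = k then 1 / (N : ℂ) else 0

/-- `A 1, …, A t` are independent `GUE(N)` matrices: each is `GUE(N)`, and the upper triangular
entries of all of them taken together form an independent family. -/
structure IsIndepGUE {Ω : Type*} [MeasurableSpace Ω] (P : Measure Ω) {N t : ℕ}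
    (A : Fin t → Ω → Matrix (Fin N) (Fin N) ℂ) : Prop where
  gue : ∀ r, IsGUE P (A r)
  indep : iIndepFun
    (fun (x : Fin t × {ij : Fin N × Fin N // ij.1 ≤ ij.2}) ω => A x.1 ω x.2.1.1 x.2.1.2) P

/-- Convergence in distribution, with respect to `E ∘ tr`, of a family `X N` of random
`N × N` matrices to a family `x` of variables in a non-commutative probability space: all joint
moments exist (for `N ≥ 1`) and converge as `N → ∞`. -/
def ConvergesInDistribution {Ω : ℕ → Type w} [∀ N, MeasurableSpace (Ω N)]
    (P : ∀ N, Measure (Ω N)) {ι : Type*}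
    (X : ∀ N, ι → Ω N → Matrix (Fin N) (Fin N) ℂ) (ℬ : NCProbSpace.{u}) (x : ι → ℬ) : Prop :=
  ∀ word : List ι,
    (∀ N, 1 ≤ N → Integrable (fun ω => normTrace (word.map fun i => X N i ω).prod) (P N)) ∧
    Tendsto (fun N => ∫ ω, normTrace (word.map fun i => X N i ω).prod ∂(P N)) atTop
      (𝓝 (ℬ.φ (word.map x).prod))

/-! ### Partitions and permutations -/

/-- A partition of a totally ordered set, given as an equivalence relation, is non-crossing. -/
def IsNonCrossing {S : Type*} [LinearOrder S] (π : Setoid S) : Prop :=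
  ¬ ∃ p₁ q₁ p₂ q₂ : S, p₁ < q₁ ∧ q₁ < p₂ ∧ p₂ < q₂ ∧ π p₁ p₂ ∧ π q₁ q₂ ∧ ¬ π p₁ q₁

/-- All blocks have exactly two elements. -/
def IsPairPartition {S : Type*} (π : Setoid S) : Prop :=
  ∀ V ∈ π.classes, V.ncard = 2

/-- The partition into the orbits of a permutation. -/
def orbitPartition {m : ℕ} (σ : Equiv.Perm (Fin m)) : Setoid (Fin m) :=
  Equiv.Perm.SameCycle.setoid σ

open Classical in
/-- Pair partitions are identified with the permutations whose orbits are the blocks; this is the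
set of the non-crossing pair partitions `π` with `π ≤ ker p`. -/
noncomputable def nonCrossingPairings {m t : ℕ} (p : Fin m → Fin t) :
    Finset (Equiv.Perm (Fin m)) :=
  {π | IsPairPartition (orbitPartition π) ∧ IsNonCrossing (orbitPartition π) ∧
    orbitPartition π ≤ Setoid.ker p}

open Classical in
/-- `φ_σ(a₁, …, a_m)`: the product, over the orbits of `σ`, of `φ` applied to the product of the
`a`'s along the orbit; each orbit is started at its smallest element `i`. -/
noncomputable def momentAlong (𝒜 : NCProbSpace.{u}) {m : ℕ} (σ : Equiv.Perm (Fin m))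
    (a : Fin m → 𝒜) : ℂ :=
  ∏ i : Fin m with (∀ j, σ.SameCycle i j → i ≤ j),
    𝒜.φ (List.ofFn fun k : Fin (Function.minimalPeriod σ i) => a ((σ ^ (k : ℕ)) i)).prod

/-- The partition `π ∪ σ` of `1 < 1' < 2 < 2' < … < m < m'`, where `π` acts on the unprimed
points `(i, false)` and `σ` on the primed points `(i, true)`. -/
def interlace {m : ℕ} (π σ : Setoid (Fin m)) : Setoid (Fin m ×ₗ Bool) where
  r x y := (ofLex x).2 = (ofLex y).2 ∧
    ((ofLex x).2 = false → π (ofLex x).1 (ofLex y).1) ∧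
    ((ofLex x).2 = true → σ (ofLex x).1 (ofLex y).1)
  iseqv :=
    { refl := fun _ => ⟨rfl, fun _ => π.refl _, fun _ => σ.refl _⟩
      symm := fun h => ⟨h.1.symm, fun e => π.symm (h.2.1 (h.1.trans e)),
        fun e => σ.symm (h.2.2 (h.1.trans e))⟩
      trans := fun h h' => ⟨h.1.trans h'.1,
        fun e => π.trans (h.2.1 e) (h'.2.1 (h.1.symm.trans e)),
        fun e => σ.trans (h.2.2 e) (h'.2.2 (h.1.symm.trans e))⟩ }

/-- `K` is the Kreweras complement of `π`: the biggest non-crossing partition `σ` such that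
`π ∪ σ` is a non-crossing partition of `1 < 1' < 2 < 2' < … < m < m'`. -/
def IsKrewerasComplement {m : ℕ} (π K : Setoid (Fin m)) : Prop :=
  IsGreatest {σ : Setoid (Fin m) | IsNonCrossing σ ∧ IsNonCrossing (interlace π σ)} K

/-! Gaussian integration by parts, applied to one letter of a word, gives the loop equation
(`IsIndepGUE.loop_equation`): for a product Q of normalized traces, E[tr(A^(r) W) Q] is the sum of
E[tr(u) tr(v) Q] over the occurrences W = u A^(r) v, plus N^-2 times a sum over the ways of splicing
W into a trace of Q. Cutting W closes up two traces, whose normalization absorbs N^-2; splicing only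
merges two loops and absorbs nothing.

All terms on the right have fewer Gaussian letters. Induction on their number shows simultaneously
that all moments converge and that expectations of products of traces factorize in the limit
(`exists_tendsto_traceMoment`). The limit ℓ is tracial and satisfies ℓ(r W) = Σ ℓ(u) ℓ(v) over W = u
r v; the rest follows mostly from this recursion.

Combinatorics: to choose an occurrence of r in W is to choose the partner of the first point in a
non-crossing pairing, with u inside the arc and v outside. Hence the sum over pairings obeys the
same recursion (`sum_gapWeight_recursion`, `IsLoopFunctional.sum_gapWeight`). The orbits of πγ are
classes of gaps between points: two gaps are equivalent when π preserves the set of points between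
them (`IsNCPairingOn.sameCycle_iff`). The same description identifies the Kreweras complement.

Freeness: on non-commutative polynomials the recursion reads φ(s_r a) = (φ ⊗ φ)(∂_r a), with ∂_r the
free difference quotient. When one s_r is peeled off an alternating centered product, every
resulting term has a factor that reduces to alternating centered products of smaller degree and so
vanishes (`SatisfiesLoopEquation.φ_polyProd_eq_zero_of_left`). For a a power of s_r the equation is
the Catalan recursion. Positivity on words in the s_r is inherited from E tr(M* M) ≥ 0. Arbitrary
realizations are covered because the joint moments of a free family are determined by the individual
ones (`FreeVariables.φ_polyProd_eq`). -/

/-! ### Gaussian integration by parts -/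

/-- All moments of the random variable `f` are finite. -/
def HasAllMoments {Ω : Type*} [MeasurableSpace Ω] (P : Measure Ω) (f : Ω → ℂ) : Prop :=
  ∀ n : ℕ, MemLp f n P

namespace HasAllMoments

variable {Ω : Type*} [MeasurableSpace Ω] {P : Measure Ω} {f g : Ω → ℂ}

lemma integrable (hf : HasAllMoments P f) : Integrable f P :=
  memLp_one_iff_integrable.1 (by simpa using hf 1)

lemma const [IsFiniteMeasure P] (c : ℂ) : HasAllMoments P fun _ => c :=
  fun _ => memLp_const c

lemma add (hf : HasAllMoments P f) (hg : HasAllMoments P g) :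
    HasAllMoments P fun ω => f ω + g ω := fun n => (hf n).add (hg n)

lemma mul [IsFiniteMeasure P] (hf : HasAllMoments P f) (hg : HasAllMoments P g) :
    HasAllMoments P fun ω => f ω * g ω := by
  intro n
  have h : ENNReal.HolderTriple ((2 * n : ℕ) : ENNReal) ((2 * n : ℕ) : ENNReal) (n : ENNReal) := by
    constructor
    rw [← two_mul]
    rcases Nat.eq_zero_or_pos n with rfl | hn
    · simp
    · push_cast
      rw [ENNReal.mul_inv (by simp) (by simp), ← mul_assoc,
        ENNReal.mul_inv_cancel (by simp) (by simp), one_mul]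
  exact (hg (2 * n)).mul (hf (2 * n))

lemma sum {ι : Type*} (s : Finset ι) {f : ι → Ω → ℂ} (hf : ∀ i ∈ s, HasAllMoments P (f i)) :
    HasAllMoments P fun ω => ∑ i ∈ s, f i ω :=
  fun n => memLp_finsetSum s fun i hi => hf i hi n

lemma mvPolynomial [IsFiniteMeasure P] {σ : Type*} {Z : Ω → σ → ℂ}
    (hZ : ∀ s, HasAllMoments P fun ω => Z ω s) (p : MvPolynomial σ ℂ) :
    HasAllMoments P fun ω => MvPolynomial.eval (Z ω) p := by
  induction p using MvPolynomial.induction_on with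
  | C a => simpa using const a
  | add p q hp hq => simpa using hp.add hq
  | mul_X p s hp => simpa using hp.mul (hZ s)

lemma comp {Ω' : Type*} [MeasurableSpace Ω'] {Q : Measure Ω'} {φ : Ω' → Ω}
    (hf : HasAllMoments P f) (hφ : MeasurePreserving φ Q P) :
    HasAllMoments Q fun ω => f (φ ω) :=
  fun n => (hf n).comp_measurePreserving hφ

end HasAllMoments

section IntegrationByParts

open MvPolynomial

variable {Ω : Type*} [MeasurableSpace Ω] {P : Measure Ω} [IsProbabilityMeasure P]
  {σ : Type*} [Fintype σ]

/-- Differentiation at angle zero of the integral of a polynomial in rotated variables. -/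
lemma hasDerivAt_integral_rotation [DecidableEq σ] {Z Z' : Ω → σ → ℂ}
    (hZ : ∀ s, HasAllMoments P fun ω => Z ω s) (hZ' : ∀ s, HasAllMoments P fun ω => Z' ω s)
    (p : MvPolynomial σ ℂ) :
    ∀ w : Ω → ℂ, HasAllMoments P w →
    HasDerivAt (fun θ : ℝ => ∫ ω, w ω *
        eval (fun s => (Real.cos θ : ℂ) * Z ω s + (Real.sin θ : ℂ) * Z' ω s) p ∂P)
      (∫ ω, w ω * ∑ s, Z' ω s * eval (Z ω) (pderiv s p) ∂P) 0 := by
  have hrot : ∀ (θ : ℝ) s, HasAllMoments P fun ω =>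
      (Real.cos θ : ℂ) * Z ω s + (Real.sin θ : ℂ) * Z' ω s := fun θ s =>
    ((HasAllMoments.const _).mul (hZ s)).add ((HasAllMoments.const _).mul (hZ' s))
  have hcos : HasDerivAt (fun θ : ℝ => (Real.cos θ : ℂ)) 0 0 := by
    simpa using (Real.hasDerivAt_cos 0).ofReal_comp
  have hsin : HasDerivAt (fun θ : ℝ => (Real.sin θ : ℂ)) 1 0 := by
    simpa using (Real.hasDerivAt_sin 0).ofReal_comp
  have hD : ∀ q : MvPolynomial σ ℂ, HasAllMoments P fun ω =>
      ∑ s, Z' ω s * eval (Z ω) (pderiv s q) := fun q =>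
    .sum _ fun s _ => (hZ' s).mul (.mvPolynomial hZ _)
  -- Induction on the polynomial replaces differentiation under the integral sign: a factor `X s` is
  -- absorbed into the weight `w`, which is why the statement is carried for all weights with finite
  -- moments. Only the scalar functions cos and sin are differentiated.
  induction p using MvPolynomial.induction_on with
  | C a => intro w hw; simpa using hasDerivAt_const (0 : ℝ) (∫ ω, w ω * a ∂P)
  | add p q hp hq =>
    intro w hw
    refine (((hp w hw).add (hq w hw)).congr_of_eventuallyEq
      (.of_forall fun θ => ?_)).congr_deriv ?_
    · simp only [map_add, mul_add, Pi.add_apply]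
      exact integral_add (hw.mul (.mvPolynomial (hrot θ) p)).integrable
        (hw.mul (.mvPolynomial (hrot θ) q)).integrable
    · rw [← integral_add (hw.mul (hD p)).integrable (hw.mul (hD q)).integrable]
      simp only [map_add, mul_add, Finset.sum_add_distrib]
  | mul_X p s hp =>
    intro w hw
    have h1 := hcos.mul (hp _ (hw.mul (hZ s)))
    have h2 := hsin.mul (hp _ (hw.mul (hZ' s)))
    refine ((h1.add h2).congr_of_eventuallyEq (.of_forall fun θ => ?_)).congr_deriv ?_
    · simp only [Pi.add_apply, Pi.mul_apply]
      rw [← integral_const_mul, ← integral_const_mul, ← integral_add]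
      · congr 1; ext ω; simp; ring
      · exact ((HasAllMoments.const _).mul ((hw.mul (hZ s)).mul
          (.mvPolynomial (hrot θ) p))).integrable
      · exact ((HasAllMoments.const _).mul ((hw.mul (hZ' s)).mul
          (.mvPolynomial (hrot θ) p))).integrable
    · simp only [Real.cos_zero, Real.sin_zero, Complex.ofReal_one, Complex.ofReal_zero, zero_mul,
        one_mul, zero_add, add_zero]
      rw [← integral_add ((hw.mul (hZ s)).mul (hD p)).integrable
        ((hw.mul (hZ' s)).mul (.mvPolynomial hZ p)).integrable]
      congr 1; ext ω
      have : ∀ s', Z' ω s' * eval (Z ω) (pderiv s' (p * X s)) =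
          Z ω s * (Z' ω s' * eval (Z ω) (pderiv s' p)) +
            if s' = s then Z' ω s * eval (Z ω) p else 0 := by
        intro s'
        rw [Derivation.leibniz, pderiv_X]
        by_cases h : s' = s
        · subst h; simp; ring
        · simp [h, Ne.symm h]; ring
      simp only [this, Finset.sum_add_distrib, ← Finset.mul_sum]
      simp
      ring

/-- Integration by parts for a centered Gaussian measure on `σ → ℂ`. -/
theorem integral_coord_mul_eval_of_isGaussian (μ : Measure (σ → ℂ)) [IsGaussian μ]
    (hμ : ∀ s, ∫ z, z s ∂μ = 0) (s₀ : σ) (p : MvPolynomial σ ℂ) :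
    ∫ z, z s₀ * eval z p ∂μ = ∑ s, (∫ z, z s₀ * z s ∂μ) * ∫ z, eval z (pderiv s p) ∂μ := by
  classical
  have hid : ∀ n : ℕ, MemLp id (n : ENNReal) μ := fun n => IsGaussian.memLp_id μ n (by simp)
  have hz : ∀ s, HasAllMoments μ fun z => z s := fun s n =>
    (ContinuousLinearMap.proj (R := ℝ) (φ := fun _ : σ => ℂ) s).comp_memLp' (hid n)
  have hμ0 : μ[id] = 0 := by
    ext s
    simp only [id_eq]
    rw [eval_integral (fun s => (hz s).integrable)]
    exact hμ s
  have hfst : MeasurePreserving (Prod.fst : (σ → ℂ) × (σ → ℂ) → _) (μ.prod μ) μ :=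
    measurePreserving_fst
  have hsnd : MeasurePreserving (Prod.snd : (σ → ℂ) × (σ → ℂ) → _) (μ.prod μ) μ :=
    measurePreserving_snd
  have hZ : ∀ s, HasAllMoments (μ.prod μ) fun x => x.1 s := fun s => (hz s).comp hfst
  have hZ' : ∀ s, HasAllMoments (μ.prod μ) fun x => x.2 s := fun s => (hz s).comp hsnd
  have hrot : ∀ (θ : ℝ) s, HasAllMoments (μ.prod μ) fun x =>
      (Real.cos θ : ℂ) * x.1 s + (Real.sin θ : ℂ) * x.2 s := fun θ s =>
    ((HasAllMoments.const _).mul (hZ s)).add ((HasAllMoments.const _).mul (hZ' s))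
  -- For an independent copy `x.2` of `x.1` one has E[x.2 s₀ * p(x.1)] = 0, and the law of the pair
  -- is invariant under rotation by θ. Differentiating the rotated identity at θ = 0 gives the
  -- claim: the factor -sin θ yields -E[z s₀ * p(z)], and the rotation inside `p` yields the sum
  -- over the covariances.
  have hzero : ∀ θ : ℝ, -(Real.sin θ : ℂ) * (∫ x, x.1 s₀ *
        eval (fun s => (Real.cos θ : ℂ) * x.1 s + (Real.sin θ : ℂ) * x.2 s) p ∂(μ.prod μ)) +
      (Real.cos θ : ℂ) * (∫ x, x.2 s₀ *
        eval (fun s => (Real.cos θ : ℂ) * x.1 s + (Real.sin θ : ℂ) * x.2 s) p ∂(μ.prod μ)) = 0 := by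
    intro θ
    have h1 : ∫ x, x.2 s₀ * eval x.1 p ∂(μ.prod μ) = 0 := by
      simp_rw [mul_comm (_ : ℂ) (eval _ p)]
      rw [integral_prod_mul (fun z : σ → ℂ => eval z p) (fun z : σ → ℂ => z s₀), hμ, mul_zero]
    have hm : AEStronglyMeasurable (fun x : (σ → ℂ) × (σ → ℂ) => x.2 s₀ * eval x.1 p)
        (μ.prod μ) := ((hZ' s₀).mul (.mvPolynomial hZ p)).integrable.aestronglyMeasurable
    rw [← IsGaussian.map_rotation_eq_self hμ0 θ] at h1 hm
    rw [integral_map (by fun_prop) hm] at h1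
    rw [← h1, ← integral_const_mul, ← integral_const_mul, ← integral_add]
    · congr 1; ext x
      have e1 : (ContinuousLinearMap.rotation θ x).1 =
          fun s => (Real.cos θ : ℂ) * x.1 s + (Real.sin θ : ℂ) * x.2 s := by
        funext s
        simp [ContinuousLinearMap.rotation_apply]
      have e2 : (ContinuousLinearMap.rotation θ x).2 s₀ =
          -(Real.sin θ : ℂ) * x.1 s₀ + (Real.cos θ : ℂ) * x.2 s₀ := by
        simp [ContinuousLinearMap.rotation_apply]
      rw [e1, e2]; ring
    · exact ((HasAllMoments.const _).mul ((hZ s₀).mul (.mvPolynomial (hrot θ) p))).integrable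
    · exact ((HasAllMoments.const _).mul ((hZ' s₀).mul (.mvPolynomial (hrot θ) p))).integrable
  have hcos : HasDerivAt (fun θ : ℝ => (Real.cos θ : ℂ)) 0 0 := by
    simpa using (Real.hasDerivAt_cos 0).ofReal_comp
  have hsin : HasDerivAt (fun θ : ℝ => -(Real.sin θ : ℂ)) (-1) 0 := by
    simpa using! (Real.hasDerivAt_sin 0).ofReal_comp.neg
  have hder := (hsin.mul (hasDerivAt_integral_rotation hZ hZ' p _ (hZ s₀))).add
    (hcos.mul (hasDerivAt_integral_rotation hZ hZ' p _ (hZ' s₀)))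
  have h0 := hder.unique ((hasDerivAt_const (0 : ℝ) (0 : ℂ)).congr_of_eventuallyEq
    (Eventually.of_forall hzero))
  simp only [Real.cos_zero, Real.sin_zero, Complex.ofReal_one, Complex.ofReal_zero, zero_mul,
    one_mul, zero_add, add_zero, neg_zero] at h0
  have e1 : ∫ x : (σ → ℂ) × (σ → ℂ), x.1 s₀ * eval (fun s => x.1 s) p ∂(μ.prod μ) =
      ∫ z, z s₀ * eval z p ∂μ :=
    integral_fun_fst (μ := μ) (ν := μ) (fun z : σ → ℂ => z s₀ * eval z p) |>.trans (by simp)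
  have e2 : ∫ x : (σ → ℂ) × (σ → ℂ), x.2 s₀ * ∑ s, x.2 s * eval x.1 (pderiv s p) ∂(μ.prod μ) =
      ∑ s, (∫ z, z s₀ * z s ∂μ) * ∫ z, eval z (pderiv s p) ∂μ := by
    simp_rw [Finset.mul_sum]
    rw [integral_finsetSum]
    · refine Finset.sum_congr rfl fun s _ => ?_
      rw [mul_comm (∫ z, z s₀ * z s ∂μ), ← integral_prod_mul]
      congr 1; ext x; ring
    · exact fun s _ => ((hZ' s₀).mul ((hZ' s).mul (.mvPolynomial hZ _))).integrable
  rw [e1] at h0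
  rw [← e2]
  linear_combination -h0

end IntegrationByParts

/-! ### The joint law of independent GUE matrices -/

section JointLaw

variable {Ω : Type*} [MeasurableSpace Ω] {P : Measure Ω} {N t : ℕ}
  {A : Fin t → Ω → Matrix (Fin N) (Fin N) ℂ}

/-- The upper triangular position of an entry of a self-adjoint matrix. -/
def upperPosition (i j : Fin N) : {ij : Fin N × Fin N // ij.1 ≤ ij.2} :=
  if h : i ≤ j then ⟨(i, j), h⟩ else ⟨(j, i), (not_le.1 h).le⟩

/-- Either the identity or the conjugation, according to the position of an entry. -/
noncomputable def conjBelow (i j : Fin N) : ℂ →L[ℝ] ℂ :=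
  if i ≤ j then ContinuousLinearMap.id ℝ ℂ else (Complex.conjCLE : ℂ →L[ℝ] ℂ)

lemma IsIndepGUE.ae_entry_eq (hA : IsIndepGUE P A) (r : Fin t) (i j : Fin N) :
    (fun ω => A r ω i j) =ᵐ[P] fun ω =>
      conjBelow i j (A r ω (upperPosition i j).1.1 (upperPosition i j).1.2) := by
  filter_upwards [(hA.gue r).selfAdjoint] with ω hω
  by_cases h : i ≤ j
  · simp [upperPosition, conjBelow, h]
  · simp [upperPosition, conjBelow, h, ← hω.apply i j]

/-- Independent Gaussian variables are jointly Gaussian, and almost surely the entries below the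
diagonal are conjugates of those above it. So the whole array is a real-linear image of a Gaussian
vector. -/
theorem IsIndepGUE.hasGaussianLaw (hA : IsIndepGUE P A) :
    HasGaussianLaw (fun ω (s : Fin t × Fin N × Fin N) => A s.1 ω s.2.1 s.2.2) P := by
  have h := iIndepFun.hasGaussianLaw
    (fun x : Fin t × {ij : Fin N × Fin N // ij.1 ≤ ij.2} =>
      (hA.gue x.1).gaussian.hasGaussianLaw_eval x.2.1) hA.indep
  let T : ((Fin t × {ij : Fin N × Fin N // ij.1 ≤ ij.2}) → ℂ) →L[ℝ]
      ((Fin t × Fin N × Fin N) → ℂ) :=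
    ContinuousLinearMap.pi fun s => (conjBelow s.2.1 s.2.2).comp
      (ContinuousLinearMap.proj (s.1, upperPosition s.2.1 s.2.2))
  refine (h.map_fun T).congr ?_
  have : ∀ᵐ ω ∂P, ∀ s : Fin t × Fin N × Fin N, A s.1 ω s.2.1 s.2.2 =
      conjBelow s.2.1 s.2.2 (A s.1 ω (upperPosition s.2.1 s.2.2).1.1
        (upperPosition s.2.1 s.2.2).1.2) :=
    ae_all_iff.2 fun s => hA.ae_entry_eq s.1 s.2.1 s.2.2
  filter_upwards [this] with ω hω
  funext s
  simpa [T] using (hω s).symm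

theorem IsIndepGUE.covariance (hA : IsIndepGUE P A) (r r' : Fin t) (i j k l : Fin N) :
    ∫ ω, A r ω i j * A r' ω k l ∂P =
      if r = r' ∧ i = l ∧ j = k then 1 / (N : ℂ) else 0 := by
  by_cases hr : r = r'
  · subst hr
    simpa using (hA.gue r).covariance i j k l
  · rw [if_neg (by tauto)]
    have hind := (hA.indep.indepFun (i := (r, upperPosition i j)) (j := (r', upperPosition k l))
      (by simp [hr])).comp (conjBelow i j).continuous.measurable
        (conjBelow k l).continuous.measurable
    have hind' : IndepFun (fun ω => A r ω i j) (fun ω => A r' ω k l) P :=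
      hind.congr (hA.ae_entry_eq r i j).symm (hA.ae_entry_eq r' k l).symm
    rw [hind'.integral_fun_mul_eq_mul_integral
      ((hA.gue r).gaussian.aemeasurable (i, j)).aestronglyMeasurable
      ((hA.gue r').gaussian.aemeasurable (k, l)).aestronglyMeasurable, (hA.gue r).centered, zero_mul]

lemma IsIndepGUE.hasAllMoments (hA : IsIndepGUE P A) (s : Fin t × Fin N × Fin N) :
    HasAllMoments P fun ω => A s.1 ω s.2.1 s.2.2 :=
  fun n => ((hA.gue s.1).gaussian.hasGaussianLaw_eval s.2).memLp (by simp)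

open MvPolynomial in
/-- Integration by parts for independent GUE matrices. -/
theorem IsIndepGUE.integral_entry_mul (hA : IsIndepGUE P A) (r : Fin t) (i j : Fin N)
    (p : MvPolynomial (Fin t × Fin N × Fin N) ℂ) :
    ∫ ω, eval (fun s => A s.1 ω s.2.1 s.2.2) (X (r, i, j) * p) ∂P =
      1 / (N : ℂ) * ∫ ω, eval (fun s => A s.1 ω s.2.1 s.2.2) (pderiv (r, j, i) p) ∂P := by
  set Z : Ω → Fin t × Fin N × Fin N → ℂ := fun ω s => A s.1 ω s.2.1 s.2.2 with hZdef
  have hZ : HasGaussianLaw Z P := hA.hasGaussianLaw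
  have := hZ.isProbabilityMeasure
  have := hZ.isGaussian_map
  have hcont : ∀ q : MvPolynomial (Fin t × Fin N × Fin N) ℂ, Continuous fun z => eval z q :=
    fun q => MvPolynomial.continuous_eval q
  have hmap : ∀ f : (Fin t × Fin N × Fin N → ℂ) → ℂ, Continuous f →
      ∫ z, f z ∂(P.map Z) = ∫ ω, f (Z ω) ∂P := fun f hf =>
    integral_map hZ.aemeasurable hf.aestronglyMeasurable
  have key := integral_coord_mul_eval_of_isGaussian (P.map Z)
    (fun s => by rw [hmap _ (continuous_apply s)]; exact (hA.gue s.1).centered _ _) (r, i, j) p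
  rw [hmap (fun z => z (r, i, j) * eval z p) ((continuous_apply _).mul (hcont p))] at key
  simp only [map_mul, eval_X]
  -- With respect to the covariance without conjugation, the entry `(r, i, j)` is correlated only
  -- with the transposed entry of the same matrix.
  rw [key, Finset.sum_eq_single (r, j, i)]
  · rw [hmap (fun z => z (r, i, j) * z (r, j, i)) ((continuous_apply _).mul (continuous_apply _)),
      hmap _ (hcont _)]
    congr 1
    simpa using hA.covariance r r i j j i
  · rintro ⟨r', k, l⟩ _ hne
    rw [hmap (fun z => z (r, i, j) * z (r', k, l))
      ((continuous_apply _).mul (continuous_apply _))]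
    have := hA.covariance r r' i j k l
    rw [if_neg (by rintro ⟨rfl, rfl, rfl⟩; exact hne rfl)] at this
    simp only [hZdef, this, zero_mul]
  · simp

end JointLaw

/-! ### Occurrences of a letter in a word -/

section Splits

variable {α : Type*} [DecidableEq α]

/-- The pairs `(u, v)` with `w = u ++ r :: v`. -/
def splits (r : α) : List α → List (List α × List α)
  | [] => []
  | x :: w => (if x = r then [([], w)] else []) ++ (splits r w).map fun p => (x :: p.1, p.2)

lemma eq_append_of_mem_splits {r : α} {w : List α} {p : List α × List α} (h : p ∈ splits r w) :
    w = p.1 ++ r :: p.2 := by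
  induction w generalizing p with
  | nil => simp [splits] at h
  | cons x w ih =>
    simp only [splits, List.mem_append, List.mem_map] at h
    rcases h with h | ⟨q, hq, rfl⟩
    · split_ifs at h with hx
      · simp only [List.mem_singleton] at h
        simp [h, hx]
      · simp at h
    · simp [← ih hq]

lemma splits_append (r : α) (w w' : List α) :
    splits r (w ++ w') = ((splits r w).map fun p => (p.1, p.2 ++ w')) ++
      (splits r w').map fun p => (w ++ p.1, p.2) := by
  induction w with
  | nil => simp [splits]
  | cons x w ih =>
    by_cases h : x = r <;> simp [splits, ih, h, Function.comp_def]

/-- The words obtained from the words of `L` by replacing an occurrence of `r` by `W`. -/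
def substitutions (r : α) (W : List α) : List (List α) → List (List (List α))
  | [] => []
  | V :: L => ((splits r V).map fun p => (p.1 ++ W ++ p.2) :: L) ++
      (substitutions r W L).map fun M => V :: M

lemma sum_map_finset_sum {β ι M : Type*} [AddCommMonoid M] (l : List β) (s : Finset ι)
    (f : ι → β → M) : ∑ i ∈ s, (l.map (f i)).sum = (l.map fun b => ∑ i ∈ s, f i b).sum := by
  induction l with
  | nil => simp
  | cons b l ih => simp [Finset.sum_add_distrib, ih]

end Splits

/-! ### The loop equation -/

section LoopEquation

open MvPolynomial

variable {N t : ℕ} (D : Matrix (Fin N) (Fin N) ℂ)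

/-- The matrices with indeterminate entries, and the constant matrix `D`. -/
noncomputable def genericMatrix :
    Fin t ⊕ Unit → Matrix (Fin N) (Fin N) (MvPolynomial (Fin t × Fin N × Fin N) ℂ)
  | .inl r => Matrix.of fun i j => X (r, i, j)
  | .inr _ => D.map C

/-- The product of the generic matrices along a word. -/
noncomputable def genericWord (w : List (Fin t ⊕ Unit)) :
    Matrix (Fin N) (Fin N) (MvPolynomial (Fin t × Fin N × Fin N) ℂ) :=
  (w.map (genericMatrix D)).prod

/-- The normalized trace of the product of the generic matrices along a word. -/
noncomputable def genericTrace (w : List (Fin t ⊕ Unit)) :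
    MvPolynomial (Fin t × Fin N × Fin N) ℂ :=
  C (1 / (N : ℂ)) * (genericWord D w).trace

lemma genericWord_cons (x : Fin t ⊕ Unit) (w : List (Fin t ⊕ Unit)) :
    genericWord D (x :: w) = genericMatrix D x * genericWord D w := by
  simp [genericWord]

lemma genericWord_append (w w' : List (Fin t ⊕ Unit)) :
    genericWord D (w ++ w') = genericWord D w * genericWord D w' := by
  simp [genericWord]

lemma eval_genericTrace (A : Fin t → Matrix (Fin N) (Fin N) ℂ) (w : List (Fin t ⊕ Unit)) :
    eval (fun s : Fin t × Fin N × Fin N => A s.1 s.2.1 s.2.2) (genericTrace D w) =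
      normTrace (w.map (Sum.elim A fun _ => D)).prod := by
  set ev := eval (fun s : Fin t × Fin N × Fin N => A s.1 s.2.1 s.2.2)
  have h : ∀ w : List (Fin t ⊕ Unit),
      (genericWord D w).map ev = (w.map (Sum.elim A fun _ => D)).prod := by
    intro w
    induction w with
    | nil => simp [genericWord, Matrix.map_one]
    | cons x w ih =>
      rw [genericWord_cons, Matrix.map_mul, ih, List.map_cons, List.prod_cons]
      congr 1
      ext i j
      rcases x with r | _ <;> simp [genericMatrix, ev]
  rw [normTrace, ← h, genericTrace, map_mul, Matrix.trace, Matrix.trace, map_sum]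
  simp [ev, div_eq_inv_mul]

/-- The derivative is a matrix unit. Writing it as a product of two entries of the identity matrix
is what lets a word fall into two pieces at the differentiated letter. -/
lemma pderiv_genericMatrix (r : Fin t) (i j a b : Fin N) (x : Fin t ⊕ Unit) :
    pderiv (r, j, i) (genericMatrix D x a b) =
      if x = .inl r then (1 : Matrix (Fin N) (Fin N) _) a j *
        (1 : Matrix (Fin N) (Fin N) _) i b else 0 := by
  rcases x with r' | _
  · simp only [genericMatrix, Matrix.of_apply, pderiv_X, Pi.single_apply, Prod.mk.injEq,
      Sum.inl.injEq, Matrix.one_apply]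
    by_cases h1 : r' = r <;> by_cases h2 : a = j <;> by_cases h3 : i = b <;>
      simp [h1, h2, h3, eq_comm]
  · simp [genericMatrix]

lemma pderiv_genericWord (r : Fin t) (i j a b : Fin N) (w : List (Fin t ⊕ Unit)) :
    pderiv (r, j, i) (genericWord D w a b) =
      ((splits (.inl r) w).map fun p => genericWord D p.1 a j * genericWord D p.2 i b).sum := by
  induction w generalizing a b with
  | nil =>
    have : genericWord (t := t) D [] a b = C ((1 : Matrix (Fin N) (Fin N) ℂ) a b) := by
      by_cases h : a = b <;> simp [genericWord, Matrix.one_apply, h]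
    simp [this, splits]
  | cons x w ih =>
    have h1 : ∑ c, genericWord D w c b * pderiv (r, j, i) (genericMatrix D x a c) =
        if x = .inl r then genericWord D [] a j * genericWord D w i b else 0 := by
      simp only [pderiv_genericMatrix]
      split_ifs with h
      · have : genericWord D w i b =
            ∑ c, (1 : Matrix (Fin N) (Fin N) _) i c * genericWord D w c b := by
          rw [← Matrix.mul_apply, one_mul]
        rw [this, Finset.mul_sum]
        refine Finset.sum_congr rfl fun c _ => ?_
        simp only [genericWord, List.map_nil, List.prod_nil]
        ring
      · simp
    rw [genericWord_cons, Matrix.mul_apply, map_sum]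
    simp only [Derivation.leibniz, smul_eq_mul, Finset.sum_add_distrib]
    rw [h1, add_comm, splits, List.map_append, List.sum_append]
    congr 1
    · split_ifs <;> simp
    · simp only [ih, List.map_map, Function.comp_def, genericWord_cons, Matrix.mul_apply,
        Finset.sum_mul, ← List.sum_map_mul_left]
      rw [sum_map_finset_sum]
      simp only [mul_assoc]

lemma pderiv_genericTrace (r : Fin t) (i j : Fin N) (V : List (Fin t ⊕ Unit)) :
    pderiv (r, j, i) (genericTrace D V) = ((splits (.inl r) V).map fun p =>
      C (1 / (N : ℂ)) * ∑ a, genericWord D p.1 a j * genericWord D p.2 i a).sum := by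
  rw [genericTrace, pderiv_C_mul, Matrix.trace, map_sum, List.sum_map_mul_left,
    ← sum_map_finset_sum]
  simp only [Matrix.diag_apply, pderiv_genericWord]

/-- Splicing: the derivative opens the cyclic word `V` at a letter `r`, and `W` is inserted there.
The result is one trace with the factor 1/N of the old one, so no power of N is absorbed. -/
lemma sum_mul_pderiv_genericTrace (r : Fin t) (W V : List (Fin t ⊕ Unit)) :
    ∑ i, ∑ j, genericWord D W j i * pderiv (r, j, i) (genericTrace D V) =
      ((splits (.inl r) V).map fun p => genericTrace D (p.1 ++ W ++ p.2)).sum := by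
  simp only [pderiv_genericTrace, ← List.sum_map_mul_left, sum_map_finset_sum]
  congr 1
  refine List.map_congr_left fun p _ => ?_
  rw [genericTrace, genericWord_append, genericWord_append]
  generalize C (1 / (N : ℂ)) = c
  generalize genericWord D p.1 = U
  generalize genericWord D p.2 = V
  generalize genericWord D W = W
  have h : (U * W * V).trace = ∑ i, ∑ j, ∑ a, U a j * W j i * V i a := by
    simp only [Matrix.trace, Matrix.diag_apply, Matrix.mul_apply, Finset.sum_mul]
    rw [Finset.sum_comm]
    exact Finset.sum_congr rfl fun i _ => Finset.sum_comm
  rw [h]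
  simp only [Finset.mul_sum]
  exact Finset.sum_congr rfl fun i _ => Finset.sum_congr rfl fun j _ =>
    Finset.sum_congr rfl fun a _ => by ring

lemma sum_mul_pderiv_prod_genericTrace (r : Fin t) (W : List (Fin t ⊕ Unit))
    (L : List (List (Fin t ⊕ Unit))) :
    ∑ i, ∑ j, genericWord D W j i * pderiv (r, j, i) (L.map (genericTrace D)).prod =
      ((substitutions (.inl r) W L).map fun M => (M.map (genericTrace D)).prod).sum := by
  induction L with
  | nil => simp [substitutions]
  | cons V L ih =>
    simp only [List.map_cons, List.prod_cons, Derivation.leibniz, smul_eq_mul, mul_add,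
      Finset.sum_add_distrib]
    rw [add_comm, substitutions, List.map_append, List.sum_append]
    refine congrArg₂ (· + ·) ?_ ?_
    · rw [List.map_map]
      simp only [Function.comp_def, List.map_cons, List.prod_cons, List.sum_map_mul_right]
      rw [← sum_mul_pderiv_genericTrace, Finset.sum_mul]
      refine Finset.sum_congr rfl fun i _ => ?_
      rw [Finset.sum_mul]
      exact Finset.sum_congr rfl fun j _ => by ring
    · rw [List.map_map]
      simp only [Function.comp_def, List.map_cons, List.prod_cons, List.sum_map_mul_left]
      rw [← ih, Finset.mul_sum]
      refine Finset.sum_congr rfl fun i _ => ?_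
      rw [Finset.mul_sum]
      exact Finset.sum_congr rfl fun j _ => by ring

/-- Cutting: the indices `j`, `j` and `i`, `i` close up the two pieces separately, and the two
traces absorb the factor N^-2. -/
lemma sum_pderiv_genericWord (r : Fin t) (W : List (Fin t ⊕ Unit)) :
    C (1 / (N : ℂ)) ^ 2 * ∑ i, ∑ j, pderiv (r, j, i) (genericWord D W j i) =
      ((splits (.inl r) W).map fun p => genericTrace D p.1 * genericTrace D p.2).sum := by
  simp only [pderiv_genericWord, sum_map_finset_sum]
  rw [← List.sum_map_mul_left]
  congr 1
  refine List.map_congr_left fun p _ => ?_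
  simp only [genericTrace, Matrix.trace, Matrix.diag_apply, ← Finset.sum_mul, ← Finset.mul_sum]
  ring

variable {Ω : Type*} [MeasurableSpace Ω] {P : Measure Ω}
  {A : Fin t → Ω → Matrix (Fin N) (Fin N) ℂ}

/-- The expectation of the product of the normalized traces of the words in `L`. -/
noncomputable def traceMoment (P : Measure Ω) (A : Fin t → Ω → Matrix (Fin N) (Fin N) ℂ)
    (D : Matrix (Fin N) (Fin N) ℂ) (L : List (List (Fin t ⊕ Unit))) : ℂ :=
  ∫ ω, (L.map fun w => normTrace (w.map (Sum.elim (fun r => A r ω) fun _ => D)).prod).prod ∂P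

lemma traceMoment_eq (L : List (List (Fin t ⊕ Unit))) :
    traceMoment P A D L = ∫ ω, eval (fun s : Fin t × Fin N × Fin N => A s.1 ω s.2.1 s.2.2)
      (L.map (genericTrace D)).prod ∂P := by
  simp only [map_list_prod, List.map_map, Function.comp_def]
  exact integral_congr_ae (.of_forall fun ω => by
    simp only [eval_genericTrace D (fun r => A r ω)])

theorem IsIndepGUE.integrable_normTrace [IsProbabilityMeasure P] (hA : IsIndepGUE P A)
    (w : List (Fin t ⊕ Unit)) :
    Integrable (fun ω => normTrace (w.map (Sum.elim (fun r => A r ω) fun _ => D)).prod) P := by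
  simp only [← eval_genericTrace D (fun r => A r _)]
  exact (HasAllMoments.mvPolynomial hA.hasAllMoments _).integrable

/-- The loop equation (Schwinger-Dyson equation) for independent GUE matrices. -/
theorem IsIndepGUE.loop_equation [IsProbabilityMeasure P] (hA : IsIndepGUE P A) (r : Fin t)
    (W : List (Fin t ⊕ Unit)) (L : List (List (Fin t ⊕ Unit))) :
    traceMoment P A D ((.inl r :: W) :: L) =
      ((splits (.inl r) W).map fun p => traceMoment P A D (p.1 :: p.2 :: L)).sum +
      (1 / (N : ℂ)) ^ 2 * ((substitutions (.inl r) W L).map fun M => traceMoment P A D M).sum := by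
  -- With the expectation as a linear functional on polynomials, what remains is algebra in the
  -- polynomial ring.
  set E : MvPolynomial (Fin t × Fin N × Fin N) ℂ →ₗ[ℂ] ℂ :=
    { toFun := fun p => ∫ ω, eval (fun s : Fin t × Fin N × Fin N => A s.1 ω s.2.1 s.2.2) p ∂P
      map_add' := fun p q => by
        simp only [map_add]
        exact integral_add (HasAllMoments.mvPolynomial hA.hasAllMoments p).integrable
          (HasAllMoments.mvPolynomial hA.hasAllMoments q).integrable
      map_smul' := fun c p => by simp [integral_const_mul] } with hE
  have hC : ∀ (c : ℂ) p, E (C c * p) = c * E p := fun c p => by rw [← smul_eq_C_mul]; simp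
  have hX : ∀ i j p, E (X (r, i, j) * p) = 1 / (N : ℂ) * E (pderiv (r, j, i) p) :=
    fun i j p => hA.integral_entry_mul r i j p
  have hT : ∀ L, traceMoment P A D L = E (L.map (genericTrace D)).prod := fun L =>
    traceMoment_eq D L
  have hsum : ∀ {β : Type} (l : List β) (f : β → MvPolynomial (Fin t × Fin N × Fin N) ℂ),
      (l.map fun b => E (f b)).sum = E (l.map f).sum := fun l f => by
    rw [map_list_sum, List.map_map]; rfl
  simp only [hT]
  rw [hsum, hsum]
  simp only [List.map_cons, List.prod_cons]
  set Q := (L.map (genericTrace D)).prod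
  have hexp : genericTrace D (.inl r :: W) * Q =
      C (1 / (N : ℂ)) * ∑ i, ∑ j, X (r, i, j) * (genericWord D W j i * Q) := by
    rw [genericTrace, genericWord_cons, Matrix.trace, mul_assoc, Finset.sum_mul]
    congr 1
    refine Finset.sum_congr rfl fun i _ => ?_
    rw [Matrix.diag_apply, Matrix.mul_apply, Finset.sum_mul]
    exact Finset.sum_congr rfl fun j _ => by simp [genericMatrix, mul_assoc]
  rw [hexp, hC, map_sum]
  simp only [map_sum, hX]
  have hleib : ∀ i j : Fin N, pderiv (r, j, i) (genericWord D W j i * Q) =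
      pderiv (r, j, i) (genericWord D W j i) * Q +
        genericWord D W j i * pderiv (r, j, i) Q := fun i j => by
    rw [Derivation.leibniz]; simp only [smul_eq_mul]; ring
  simp only [hleib, ← Finset.mul_sum, ← map_sum E]
  rw [← mul_assoc, ← pow_two, ← hC, ← hC (_ ^ 2)]
  rw [← map_add]
  congr 1
  simp only [Finset.sum_add_distrib, mul_add]
  rw [sum_mul_pderiv_prod_genericTrace]
  congr 1
  simp only [← mul_assoc, ← Finset.sum_mul]
  rw [C_pow, sum_pderiv_genericWord, ← List.sum_map_mul_right]

end LoopEquation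

/-! ### Convergence of the moments -/

/-- A functional on words in `Fin t ⊕ Unit` that is tracial, satisfies the limiting loop equation
for the letters `inl r`, and has the moments `μ` in the letter `inr ()`. -/
structure IsLoopFunctional {t : ℕ} (μ : ℕ → ℂ) (ℓ : List (Fin t ⊕ Unit) → ℂ) : Prop where
  cyclic : ∀ u v, ℓ (u ++ v) = ℓ (v ++ u)
  loop : ∀ r W, ℓ (.inl r :: W) = ((splits (.inl r) W).map fun p => ℓ p.1 * ℓ p.2).sum
  moments : ∀ k, ℓ (List.replicate k (.inr ())) = μ k

section TraceMoment

variable {Ω : Type*} [MeasurableSpace Ω] {N t : ℕ} (P : Measure Ω)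
  (A : Fin t → Ω → Matrix (Fin N) (Fin N) ℂ) (D : Matrix (Fin N) (Fin N) ℂ)

lemma traceMoment_perm {L L' : List (List (Fin t ⊕ Unit))} (h : L.Perm L') :
    traceMoment P A D L = traceMoment P A D L' :=
  integral_congr_ae (.of_forall fun _ => (h.map _).prod_eq)

lemma traceMoment_rotate (u v : List (Fin t ⊕ Unit)) (L : List (List (Fin t ⊕ Unit))) :
    traceMoment P A D ((u ++ v) :: L) = traceMoment P A D ((v ++ u) :: L) := by
  refine integral_congr_ae (.of_forall fun ω => ?_)
  simp only [List.map_cons, List.prod_cons, List.map_append, List.prod_append, normTrace]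
  rw [Matrix.trace_mul_comm]

end TraceMoment

/-- The number of letters `inl _` in the words of `L`. -/
def leftCount {t : ℕ} (L : List (List (Fin t ⊕ Unit))) : ℕ :=
  (L.map (List.countP fun x => x.isLeft)).sum

lemma leftCount_cons {t : ℕ} (w : List (Fin t ⊕ Unit)) (L) :
    leftCount (w :: L) = w.countP (fun x => x.isLeft) + leftCount L := by
  simp [leftCount]

lemma leftCount_of_mem_substitutions {t : ℕ} {r : Fin t} {W : List (Fin t ⊕ Unit)}
    {L M : List (List (Fin t ⊕ Unit))} (h : M ∈ substitutions (.inl r) W L) :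
    leftCount M + 1 = leftCount (W :: L) := by
  induction L generalizing M with
  | nil => simp [substitutions] at h
  | cons V L ih =>
    simp only [substitutions, List.mem_append, List.mem_map] at h
    rcases h with ⟨p, hp, rfl⟩ | ⟨M', hM', rfl⟩
    · rw [eq_append_of_mem_splits hp]
      simp [leftCount_cons, List.countP_cons]; ring
    · have := ih hM'
      simp only [leftCount_cons] at this ⊢
      omega

lemma leftCount_of_mem_splits {t : ℕ} {r : Fin t} {W : List (Fin t ⊕ Unit)}
    {p : List (Fin t ⊕ Unit) × List (Fin t ⊕ Unit)} (h : p ∈ splits (.inl r) W)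
    (L : List (List (Fin t ⊕ Unit))) :
    leftCount (p.1 :: p.2 :: L) + 1 = leftCount (W :: L) := by
  rw [eq_append_of_mem_splits h]
  simp [leftCount_cons, List.countP_cons]; ring

lemma eq_replicate_of_countP_isLeft_eq_zero {t : ℕ} {w : List (Fin t ⊕ Unit)}
    (h : w.countP (fun x => x.isLeft) = 0) : w = List.replicate w.length (.inr ()) := by
  rw [List.eq_replicate_iff]
  refine ⟨rfl, fun x hx => ?_⟩
  have := List.countP_eq_zero.1 h x hx
  rcases x with x | x
  · simp at this
  · rfl

section Convergence

variable {t : ℕ} {Ω : ℕ → Type w} [∀ N, MeasurableSpace (Ω N)]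
  {P : ∀ N, Measure (Ω N)} [∀ N, IsProbabilityMeasure (P N)]
  {A : ∀ N, Fin t → Ω N → Matrix (Fin N) (Fin N) ℂ} {D : ∀ N, Matrix (Fin N) (Fin N) ℂ}

lemma normTrace_one {N : ℕ} (hN : 1 ≤ N) : normTrace (1 : Matrix (Fin N) (Fin N) ℂ) = 1 := by
  have : (N : ℂ) ≠ 0 := by exact_mod_cast (by omega : N ≠ 0)
  simp [normTrace, this]

/-- The limits of the expectations of products of normalized traces. -/
theorem exists_tendsto_traceMoment (hA : ∀ N, 1 ≤ N → IsIndepGUE (P N) (A N)) {μ : ℕ → ℂ}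
    (hμ : ∀ k, Tendsto (fun N => normTrace (D N ^ k)) atTop (𝓝 (μ k))) :
    ∃ ℓ : List (Fin t ⊕ Unit) → ℂ, IsLoopFunctional μ ℓ ∧ ∀ L,
      Tendsto (fun N => traceMoment (P N) (A N) (D N) L) atTop (𝓝 (L.map ℓ).prod) := by
  set T : ∀ N, List (List (Fin t ⊕ Unit)) → ℂ := fun N => traceMoment (P N) (A N) (D N)
  -- `limUnder` has an arbitrary value before convergence is known; `hlim` identifies `ℓ w` as soon
  -- as a limit is found. Traciality needs no convergence, since the two sequences coincide.
  obtain ⟨ℓ, hℓ⟩ : ∃ ℓ : List (Fin t ⊕ Unit) → ℂ, ∀ w, ℓ w = limUnder atTop fun N => T N [w] :=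
    ⟨_, fun _ => rfl⟩
  have hlim : ∀ {w c}, Tendsto (fun N => T N [w]) atTop (𝓝 c) → ℓ w = c := fun h =>
    (hℓ _).trans h.limUnder_eq
  have hcyc : ∀ u v, ℓ (u ++ v) = ℓ (v ++ u) := fun u v => by
    rw [hℓ, hℓ]
    congr 1
    funext N
    exact traceMoment_rotate (P N) (A N) (D N) u v []
  have hrep : ∀ N k, T N [List.replicate k (.inr ())] = normTrace (D N ^ k) := fun N k => by
    simp [T, traceMoment]
  have hmom : ∀ k, ℓ (List.replicate k (.inr ())) = μ k := fun k => hlim (by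
    simpa only [hrep] using hμ k)
  have hzero : ∀ L, leftCount L = 0 → Tendsto (fun N => T N L) atTop (𝓝 (L.map ℓ).prod) := by
    intro L
    have hT : ∀ N, leftCount L = 0 →
        T N L = (L.map fun w => normTrace (D N ^ w.length)).prod := by
      intro N h
      simp only [leftCount, List.sum_eq_zero_iff, List.mem_map, forall_exists_index, and_imp,
        forall_apply_eq_imp_iff₂] at h
      have : ∀ ω, (L.map fun w => normTrace
          (w.map (Sum.elim (fun r => A N r ω) fun _ => D N)).prod) =
          L.map fun w => normTrace (D N ^ w.length) := fun ω => by
        refine List.map_congr_left fun w hw => ?_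
        conv_lhs => rw [eq_replicate_of_countP_isLeft_eq_zero (h w hw)]
        simp
      simp [T, traceMoment, this]
    intro h
    simp only [fun N => hT N h]
    refine tendsto_list_prod L fun w hw => ?_
    simp only [leftCount, List.sum_eq_zero_iff, List.mem_map, forall_exists_index, and_imp,
        forall_apply_eq_imp_iff₂] at h
    rw [eq_replicate_of_countP_isLeft_eq_zero (h w hw), hmom, List.length_replicate]
    exact hμ _
  -- All lists on the right of the loop equation have fewer letters `inl _`, so their moments
  -- converge by assumption, and the factor N^-2 removes the spliced terms.
  have hstep : ∀ r W L, (∀ L', leftCount L' < leftCount ((.inl r :: W) :: L) →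
        Tendsto (fun N => T N L') atTop (𝓝 (L'.map ℓ).prod)) →
      Tendsto (fun N => T N ((.inl r :: W) :: L)) atTop
        (𝓝 (((splits (.inl r) W).map fun p => ℓ p.1 * ℓ p.2).sum * (L.map ℓ).prod)) := by
    intro r W L ih
    have hcount : leftCount ((.inl r :: W) :: L) = leftCount (W :: L) + 1 := by
      simp [leftCount_cons, List.countP_cons]; ring
    have h1 : Tendsto (fun N => ((splits (.inl r) W).map fun p => T N (p.1 :: p.2 :: L)).sum) atTop
        (𝓝 (((splits (.inl r) W).map fun p => ℓ p.1 * ℓ p.2).sum * (L.map ℓ).prod)) := by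
      rw [← List.sum_map_mul_right]
      refine tendsto_list_sum _ fun p hp => ?_
      have := leftCount_of_mem_splits hp L
      simpa [mul_assoc] using ih (p.1 :: p.2 :: L) (by omega)
    have h2 : Tendsto (fun N => ((substitutions (.inl r) W L).map fun M => T N M).sum) atTop
        (𝓝 ((substitutions (.inl r) W L).map fun M => (M.map ℓ).prod).sum) := by
      refine tendsto_list_sum _ fun M hM => ?_
      have := leftCount_of_mem_substitutions hM
      exact ih M (by omega)
    have h3 : Tendsto (fun N : ℕ => (1 / (N : ℂ)) ^ 2) atTop (𝓝 0) := by
      simpa using (tendsto_one_div_atTop_nhds_zero_nat (𝕜 := ℂ)).pow 2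
    have h4 := h1.add (h3.mul h2)
    rw [zero_mul, add_zero] at h4
    refine h4.congr' ?_
    filter_upwards [eventually_ge_atTop 1] with N hN
    exact ((hA N hN).loop_equation (D N) r W L).symm
  have hall : ∀ n L, leftCount L = n →
      Tendsto (fun N => T N L) atTop (𝓝 (L.map ℓ).prod) := by
    intro n
    induction n using Nat.strong_induction_on with
    | _ n ih =>
    intro L hL
    by_cases h0 : leftCount L = 0
    · exact hzero L h0
    obtain ⟨w, hw, hw0⟩ : ∃ w ∈ L, w.countP (fun x => x.isLeft) ≠ 0 := by
      by_contra! h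
      exact h0 (by simpa [leftCount, List.sum_eq_zero_iff] using h)
    obtain ⟨x, hx, hxl⟩ : ∃ x ∈ w, x.isLeft = true := by
      simpa using List.countP_pos_iff.1 (Nat.pos_of_ne_zero hw0)
    obtain ⟨r, rfl⟩ := Sum.isLeft_iff.1 hxl
    obtain ⟨a, b, rfl⟩ := List.append_of_mem hx
    -- Neither the order of the words nor the starting point of a word under the trace matters, so a
    -- word containing some `inl r` can be moved to the front and rotated to begin with it.
    obtain ⟨L', hL'⟩ : ∃ L', L.Perm ((a ++ .inl r :: b) :: L') :=
      (List.append_of_mem hw).elim fun l₁ ⟨l₂, h⟩ => ⟨l₁ ++ l₂, h ▸ List.perm_middle⟩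
    have hcnt : leftCount L = leftCount ((.inl r :: (b ++ a)) :: L') := by
      have : leftCount L = leftCount ((a ++ .inl r :: b) :: L') := (hL'.map _).sum_eq
      rw [this]
      simp [leftCount_cons, List.countP_cons]; ring
    have e1 : ∀ N, T N L = T N ((.inl r :: (b ++ a)) :: L') := fun N => by
      simp only [T]
      rw [traceMoment_perm _ _ _ hL', traceMoment_rotate]
      rfl
    have hw1 : ℓ (a ++ .inl r :: b) = ℓ (.inl r :: (b ++ a)) := hcyc _ _
    -- The step for the one-word list comes first: it identifies the value of `ℓ` that must appear
    -- in the limit for the full list.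
    have hw2 : ℓ (.inl r :: (b ++ a)) =
        ((splits (.inl r) (b ++ a)).map fun p => ℓ p.1 * ℓ p.2).sum := by
      refine hlim ?_
      have := hstep r (b ++ a) [] fun M hM => ih _ (lt_of_lt_of_le hM (by
        rw [← hL, hcnt, leftCount_cons, leftCount_cons]; simp [leftCount])) M rfl
      simpa using this
    rw [(hL'.map ℓ).prod_eq]
    simp only [e1, List.map_cons, List.prod_cons]
    rw [hw1, hw2]
    exact hstep r (b ++ a) L' fun M hM => ih _ (by omega) M rfl
  refine ⟨ℓ, ⟨hcyc, fun r W => hlim ?_, hmom⟩, fun L => hall _ L rfl⟩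
  simpa using hstep r W [] fun M _ => hall _ M rfl

end Convergence

/-! ### Non-crossing pairings -/

section NonCrossing

variable {m t : ℕ}

/-- `π` restricts to a non-crossing pairing of `{x | a ≤ x < b}` that respects the colours `p`, and
is the identity elsewhere. -/
structure IsNCPairingOn (p : Fin m → Fin t) (a b : ℕ) (π : Equiv.Perm (Fin m)) : Prop where
  fix : ∀ x : Fin m, ¬ (a ≤ (x : ℕ) ∧ (x : ℕ) < b) → π x = x
  maps : ∀ x : Fin m, a ≤ (x : ℕ) → (x : ℕ) < b → a ≤ (π x : ℕ) ∧ (π x : ℕ) < b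
  invol : ∀ x, π (π x) = x
  ne : ∀ x : Fin m, a ≤ (x : ℕ) → (x : ℕ) < b → (π x : ℕ) ≠ x
  nc : ∀ x y : Fin m, (x : ℕ) < y → (y : ℕ) < π x → (x : ℕ) < π y ∧ (π y : ℕ) < π x
  color : ∀ x, p (π x) = p x

/-- Gap `g` sits immediately before point `g`. Two gaps are related if the set of the points
between them is invariant under `π`. -/
def GapRel (π : Equiv.Perm (Fin m)) (g h : ℕ) : Prop :=
  ∀ x : Fin m, (g ≤ (x : ℕ) ↔ h ≤ (x : ℕ)) ↔ (g ≤ (π x : ℕ) ↔ h ≤ (π x : ℕ))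

namespace GapRel

variable {π : Equiv.Perm (Fin m)} {g h k : ℕ}

lemma refl (π : Equiv.Perm (Fin m)) (g : ℕ) : GapRel π g g := fun x => by tauto

lemma symm (H : GapRel π g h) : GapRel π h g := fun x => by have := H x; tauto

/-- A point lies between `g` and `k` exactly when it lies between one, but not both, of the pairs
`g, h` and `h, k`; so invariance passes on. -/
lemma trans (H : GapRel π g h) (H' : GapRel π h k) : GapRel π g k := fun x => by
  have := H x; have := H' x; tauto

lemma zero_top (π : Equiv.Perm (Fin m)) : GapRel π 0 m := fun x => by
  have := x.2; have := (π x).2; omega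

/-- Invariance can be checked in one direction for an involution. -/
lemma of_maps (hπ : ∀ x, π (π x) = x) (hgh : g ≤ h)
    (H : ∀ x : Fin m, g ≤ (x : ℕ) → (x : ℕ) < h → g ≤ (π x : ℕ) ∧ (π x : ℕ) < h) :
    GapRel π g h := fun x => by
  have h1 := H x
  have h2 := H (π x)
  rw [hπ x] at h2
  omega

end GapRel

namespace IsNCPairingOn

variable {p : Fin m → Fin t} {a b : ℕ} {π : Equiv.Perm (Fin m)}

/-- By the non-crossing condition an arc encloses only complete arcs. For `y < π y` the points
between the two gaps form the closed interval from `y` to `π y`, otherwise the open interval from `π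
y` to `y`; both are invariant. -/
lemma gapRel_point (H : IsNCPairingOn p 0 m π) (y : Fin m) : GapRel π y (π y + 1) := by
  have hne := H.ne y (by omega) y.2
  have hy := H.invol y
  have inj : ∀ x z : Fin m, (π x : ℕ) = π z ↔ (x : ℕ) = z := fun x z => by
    rw [← Fin.ext_iff, ← Fin.ext_iff, π.injective.eq_iff]
  intro x
  have hx := H.invol x
  have i1 := inj x y
  have i2 := inj x (π y)
  have a1 := H.nc y x
  have a2 := H.nc (π y) x
  have a3 := H.nc y (π x)
  have a4 := H.nc (π y) (π x)
  rw [hy] at i2 a2 a4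
  rw [hx] at a3 a4
  omega

/-- The gap before the rotated point is the gap after `i`, so `gapRel_point` applies. For the last
point it is gap 0 instead, which is related to gap `m`. -/
lemma gapRel_rotate (H : IsNCPairingOn p 0 m π) (i : Fin m) :
    GapRel π (i + 1) ((π * finRotate m) i + 1) := by
  have hm : 0 < m := i.pos
  obtain ⟨n, rfl⟩ : ∃ n, m = n + 1 := ⟨m - 1, by omega⟩
  have h := H.gapRel_point (finRotate (n + 1) i)
  by_cases hi : i = Fin.last n
  · subst hi
    simp only [Equiv.Perm.mul_apply]
    simp only [finRotate_last, Fin.val_last] at h ⊢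
    exact (GapRel.zero_top π).symm.trans h
  · have : ((finRotate (n + 1) i : Fin (n + 1)) : ℕ) = i + 1 := coe_finRotate_of_ne_last hi
    rw [this] at h
    exact h

lemma sameCycle_iff (H : IsNCPairingOn p 0 m π) (i j : Fin m) :
    (π * finRotate m).SameCycle i j ↔ GapRel π (i + 1) (j + 1) := by
  constructor
  · intro h
    obtain ⟨n, rfl⟩ := h.exists_nat_pow_eq
    clear h
    induction n with
    | zero => exact GapRel.refl _ _
    | succ n ih =>
      rw [pow_succ', Equiv.Perm.mul_apply]
      exact ih.trans (H.gapRel_rotate _)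
  · have key : ∀ n, ∀ i j : Fin m, (j : ℕ) = i + n → GapRel π (i + 1) (j + 1) →
        (π * finRotate m).SameCycle i j := by
      intro n
      induction n using Nat.strong_induction_on with
      | _ n ih =>
      intro i j hij h
      rcases Nat.eq_zero_or_pos n with rfl | hn
      · rw [show j = i from Fin.ext (by omega)]
      · obtain ⟨m', rfl⟩ : ∃ m', m = m' + 1 := ⟨m - 1, by have := i.2; omega⟩
        set k := (π * finRotate (m' + 1)) i with hk
        have hik : GapRel π (i + 1) (k + 1) := H.gapRel_rotate i
        have hil : i ≠ Fin.last m' := fun e => by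
          have := congrArg Fin.val e; simp at this; omega
        have hrot : ((finRotate (m' + 1) i : Fin (m' + 1)) : ℕ) = i + 1 :=
          coe_finRotate_of_ne_last hil
        -- The point `i + 1` lies between the gaps `i + 1` and `j + 1`, hence so does its partner
        -- `k`. One step along the cycle thus approaches `j` without passing it.
        have hy := h (finRotate (m' + 1) i)
        rw [hrot] at hy
        have hk' : ((π (finRotate (m' + 1) i) : Fin (m' + 1)) : ℕ) = k := by
          rw [hk, Equiv.Perm.mul_apply]
        rw [hk'] at hy
        have : (π * finRotate (m' + 1)).SameCycle k j :=
          ih (j - k) (by omega) k j (by omega) (hik.symm.trans h)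
        exact (Equiv.Perm.sameCycle_apply_left.1 this)
    intro h
    rcases le_total (i : ℕ) j with hij | hij
    · exact key (j - i) i j (by omega) h
    · exact (key (i - j) j i (by omega) h.symm).symm

lemma sameCycle_iff_eq_or (H : IsNCPairingOn p 0 m π) (i j : Fin m) :
    π.SameCycle i j ↔ j = i ∨ j = π i := by
  constructor
  · intro h
    obtain ⟨n, rfl⟩ := h.exists_nat_pow_eq
    clear h
    induction n with
    | zero => exact .inl rfl
    | succ n ih =>
      rw [pow_succ', Equiv.Perm.mul_apply]
      rcases ih with h | h
      · rw [h]; exact .inr rfl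
      · rw [h, H.invol]; exact .inl rfl
  · rintro (rfl | rfl)
    · exact .refl _ _
    · exact Equiv.Perm.sameCycle_apply_right.2 (.refl _ _)

lemma isPairPartition (H : IsNCPairingOn p 0 m π) : IsPairPartition (orbitPartition π) := by
  rintro V ⟨x, rfl⟩
  have : {y | orbitPartition π y x} = {x, π x} := by
    ext y
    have : orbitPartition π y x ↔ π.SameCycle x y := Equiv.Perm.sameCycle_comm
    simp only [Set.mem_ofPred_eq, this, H.sameCycle_iff_eq_or, Set.mem_insert_iff,
      Set.mem_singleton_iff]
  rw [this]
  exact Set.ncard_pair fun h => H.ne x (by omega) x.2 (congrArg Fin.val h.symm)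

lemma isNonCrossing (H : IsNCPairingOn p 0 m π) : IsNonCrossing (orbitPartition π) := by
  rintro ⟨x, y, x', y', h1, h2, h3, hx, hy, -⟩
  have hx : π.SameCycle x x' := hx
  have hy : π.SameCycle y y' := hy
  rw [H.sameCycle_iff_eq_or] at hx hy
  rcases hx with rfl | rfl
  · omega
  rcases hy with rfl | rfl
  · omega
  have := H.nc x y h1 h2
  omega

/-- The orbits of `π * finRotate m` form the Kreweras complement of `π`. -/
theorem isKrewerasComplement (H : IsNCPairingOn p 0 m π) :
    IsKrewerasComplement (orbitPartition π) (orbitPartition (π * finRotate m)) := by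
  have hK : ∀ i j, orbitPartition (π * finRotate m) i j ↔ GapRel π (i + 1) (j + 1) :=
    H.sameCycle_iff
  have hπ : ∀ i j, orbitPartition π i j ↔ j = i ∨ j = π i := H.sameCycle_iff_eq_or
  have hNC : IsNonCrossing (orbitPartition (π * finRotate m)) := by
    rintro ⟨x, y, x', y', h1, h2, h3, hx, hy, hxy⟩
    rw [hK] at hx hy hxy
    refine hxy fun z => ?_
    have := hx z
    have := hy z
    omega
  refine ⟨⟨hNC, ?_⟩, ?_⟩
  · rintro ⟨x, y, x', y', h1, h2, h3, hx, hy, hxy⟩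
    induction x with | h x
    induction y with | h y
    induction x' with | h x'
    induction y' with | h y'
    obtain ⟨x, bx⟩ := x
    obtain ⟨y, by'⟩ := y
    obtain ⟨x', bx'⟩ := x'
    obtain ⟨y', by''⟩ := y'
    obtain ⟨rfl, hx0, hx1⟩ := hx
    obtain ⟨rfl, hy0, hy1⟩ := hy
    simp only [ofLex_toLex] at hx0 hx1 hy0 hy1
    rw [Prod.Lex.toLex_lt_toLex] at h1 h2 h3
    simp only at h1 h2 h3
    -- Crossings within one kind of points are excluded by the two non-crossing properties. In a
    -- mixed crossing exactly one end of an arc of `π` would lie between two related gaps.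
    cases bx <;> cases by'
    · refine H.isNonCrossing ⟨x, y, x', y', by simpa using h1, by simpa using h2,
        by simpa using h3, hx0 rfl, hy0 rfl, fun h => hxy ⟨rfl, fun _ => h, by simp⟩⟩
    · have hx := (hπ _ _).1 (hx0 rfl)
      have hy := (hK _ _).1 (hy1 rfl)
      have h1' : x ≤ y := by rcases h1 with h | h; exacts [h.le, h.1.le]
      have h2' : y < x' := by simpa [show ¬ (true < false) by decide] using h2
      have h3' : x' ≤ y' := by rcases h3 with h | h; exacts [h.le, h.1.le]
      rcases hx with rfl | rfl
      · omega
      · have := hy x; omega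
    · have hx := (hK _ _).1 (hx1 rfl)
      have hy := (hπ _ _).1 (hy0 rfl)
      have h1' : x < y := by simpa [show ¬ (true < false) by decide] using h1
      have h2' : y ≤ x' := by rcases h2 with h | h; exacts [h.le, h.1.le]
      have h3' : x' < y' := by simpa [show ¬ (true < false) by decide] using h3
      rcases hy with rfl | rfl
      · omega
      · have := hx y; omega
    · refine hNC ⟨x, y, x', y', by simpa using h1, by simpa using h2,
        by simpa using h3, hx1 rfl, hy1 rfl, fun h => hxy ⟨rfl, by simp, fun _ => h⟩⟩
  · rintro τ ⟨-, hτ⟩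
    -- Maximality: if `τ` joins `i < j` and an arc of `π` leaves the set of points between the gaps
    -- `i + 1` and `j + 1`, to the right or to the left, then this arc crosses the pair of primed
    -- points on the interlaced line.
    have key : ∀ i j : Fin m, (i : ℕ) < j → τ i j → GapRel π (i + 1) (j + 1) := by
      intro i j hij h
      refine GapRel.of_maps H.invol (by omega) fun x hx1 hx2 => ?_
      by_contra hcon
      rcases lt_or_ge (i : ℕ) (π x) with hlt | hle
      · refine hτ ⟨toLex (i, true), toLex (x, false), toLex (j, true), toLex (π x, false),
          ?_, ?_, ?_, ⟨rfl, by simp, fun _ => h⟩, ⟨rfl, fun _ => (hπ _ _).2 (.inr rfl), by simp⟩,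
          fun h => by simpa using h.1⟩ <;> rw [Prod.Lex.toLex_lt_toLex]
        · left; simp only; omega
        · simp; omega
        · left; simp only; omega
      · refine hτ ⟨toLex (π x, false), toLex (i, true), toLex (x, false), toLex (j, true),
          ?_, ?_, ?_, ⟨rfl, fun _ => (hπ _ _).2 (.inr (H.invol x).symm), by simp⟩,
          ⟨rfl, by simp, fun _ => h⟩, fun h => by simpa using h.1⟩ <;>
          rw [Prod.Lex.toLex_lt_toLex]
        · simp; omega
        · left; simp only; omega
        · simp; omega
    intro i j h
    refine (hK i j).2 ?_
    rcases lt_trichotomy (i : ℕ) j with hij | hij | hij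
    · exact key i j hij h
    · rw [hij]; exact GapRel.refl _ _
    · exact (key j i hij (τ.symm h)).symm

end IsNCPairingOn

lemma apply_apply_of_isPairPartition {π : Equiv.Perm (Fin m)}
    (h : IsPairPartition (orbitPartition π)) (x : Fin m) : π x ≠ x ∧ π (π x) = x := by
  have hc := h _ (Setoid.mem_classes (orbitPartition π) x)
  obtain ⟨y, z, hyz, hV⟩ := Set.ncard_eq_two.1 hc
  have hmem : ∀ w, π.SameCycle w x ↔ w = y ∨ w = z := fun w => by
    have : w ∈ {w | orbitPartition π w x} ↔ w ∈ ({y, z} : Set (Fin m)) := by rw [hV]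
    have e : orbitPartition π w x ↔ π.SameCycle w x := Iff.rfl
    simpa [e] using this
  have h0 := (hmem x).1 (.refl _ _)
  have h1 := (hmem (π x)).1 (Equiv.Perm.sameCycle_apply_left.2 (.refl _ _))
  have h2 := (hmem (π (π x))).1
    (Equiv.Perm.sameCycle_apply_left.2 (Equiv.Perm.sameCycle_apply_left.2 (.refl _ _)))
  have hne : π x ≠ x := by
    intro hx
    have : ∀ w, π.SameCycle x w → w = x := fun w hw => by
      obtain ⟨n, rfl⟩ := hw.exists_nat_pow_eq
      exact Equiv.Perm.pow_apply_eq_self_of_apply_eq_self hx n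
    exact hyz ((this y ((hmem y).2 (.inl rfl)).symm).trans
      (this z ((hmem z).2 (.inr rfl)).symm).symm)
  refine ⟨hne, ?_⟩
  have hne' : π (π x) ≠ π x := fun e => hne (π.injective e)
  rcases h0 with rfl | rfl <;> rcases h1 with h1 | h1 <;> rcases h2 with h2 | h2 <;> simp_all

open Classical in
/-- The non-crossing pairings of an interval, compatible with the colours `p`. -/
noncomputable def ncPairingsOn (p : Fin m → Fin t) (a b : ℕ) : Finset (Equiv.Perm (Fin m)) :=
  {π | IsNCPairingOn p a b π}

lemma mem_ncPairingsOn {p : Fin m → Fin t} {a b : ℕ} {π : Equiv.Perm (Fin m)} :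
    π ∈ ncPairingsOn p a b ↔ IsNCPairingOn p a b π := by
  simp [ncPairingsOn]

theorem nonCrossingPairings_eq (p : Fin m → Fin t) :
    nonCrossingPairings p = ncPairingsOn p 0 m := by
  ext π
  rw [mem_ncPairingsOn]
  simp only [nonCrossingPairings, Finset.mem_filter, Finset.mem_univ, true_and]
  constructor
  · rintro ⟨hpair, hnc, hcol⟩
    have hi := fun x => (apply_apply_of_isPairPartition hpair x).2
    have hne := fun x => (apply_apply_of_isPairPartition hpair x).1
    have hs : ∀ x, π.SameCycle x (π x) := fun x =>
      Equiv.Perm.sameCycle_apply_right.2 (.refl _ _)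
    -- Crossing arcs belong to different blocks, as required for a crossing: otherwise one block
    -- would contain the three points `x`, `y`, `π x`.
    have hcross : ∀ x y : Fin m, x < y → y < π x → π x < π y → False := by
      intro x y h1 h2 h3
      refine hnc ⟨x, y, π x, π y, h1, h2, h3, hs x, hs y, fun h => ?_⟩
      have hc := hpair _ (Setoid.mem_classes (orbitPartition π) x)
      have h3' : ({x, y, π x} : Set (Fin m)) ⊆ {z | orbitPartition π z x} := by
        rintro z (rfl | rfl | rfl)
        · exact (orbitPartition π).refl _
        · exact (orbitPartition π).symm h
        · exact (hs x).symm
      have := Set.ncard_le_ncard h3' (Set.toFinite _)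
      rw [hc, Set.ncard_eq_toFinset_card' ] at this
      have h4 : ({x, y, π x} : Set (Fin m)).toFinset = {x, y, π x} := by ext; simp
      rw [h4, Finset.card_eq_three.2 ⟨x, y, π x, h1.ne, (h1.trans h2).ne, h2.ne, rfl⟩] at this
      omega
    refine ⟨fun x hx => absurd ⟨by omega, x.2⟩ hx, fun x _ _ => ⟨by omega, (π x).2⟩, hi,
      fun x _ _ h => hne x (Fin.ext h), fun x y h1 h2 => ?_, fun x => ?_⟩
    · have i1 : π y ≠ x := fun e => by
        have := congrArg π e; rw [hi] at this; omega
      have i2 : π y ≠ π x := fun e => by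
        have := π.injective e; omega
      have c1 := hcross x y h1 h2
      have c2 := hcross (π y) x
      rw [hi] at c2
      have c2' : ¬ π y < x := fun h => c2 h h1 h2
      have c1' : ¬ π x < π y := c1
      omega
    · exact (hcol (hs x)).symm
  · intro H
    refine ⟨H.isPairPartition, H.isNonCrossing, fun {i j} h => ?_⟩
    rw [Setoid.ker_def]
    rcases (H.sameCycle_iff_eq_or i j).1 h with rfl | rfl
    · rfl
    · exact (H.color i).symm

end NonCrossing

/-! ### The recursion for the sum over non-crossing pairings -/

section Weights

variable {m t : ℕ} {p : Fin m → Fin t}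

open Classical in
/-- The product over the classes of the gaps between `a` and `b`, each represented by its greatest
element, of the moment whose order is the sum of the `q`'s over the class. -/
noncomputable def gapWeight (μ : ℕ → ℂ) (q : ℕ → ℕ) (π : Equiv.Perm (Fin m)) (a b : ℕ) : ℂ :=
  ∏ g ∈ Finset.Icc a b with ∀ h ∈ Finset.Icc a b, GapRel π g h → h ≤ g,
    μ (∑ h ∈ Finset.Icc a b with GapRel π g h, q h)

lemma IsNCPairingOn.eq_one {a : ℕ} {π : Equiv.Perm (Fin m)} (H : IsNCPairingOn p a a π) :
    π = 1 := by
  ext x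
  rw [H.fix x (by omega)]
  rfl

lemma isNCPairingOn_one (p : Fin m → Fin t) (a : ℕ) : IsNCPairingOn p a a 1 where
  fix x _ := rfl
  maps x h1 h2 := by omega
  invol x := rfl
  ne x h1 h2 := by omega
  nc x y h1 h2 := by simp only [Equiv.Perm.coe_one, id_eq] at h2 ⊢; omega
  color x := rfl

lemma gapWeight_self (μ : ℕ → ℂ) (q : ℕ → ℕ) (π : Equiv.Perm (Fin m)) (a : ℕ) :
    gapWeight μ q π a a = μ (q a) := by
  simp [gapWeight, Finset.filter_singleton, GapRel.refl]

/-- Restriction of a non-crossing pairing to an invariant interval. -/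
lemma IsNCPairingOn.exists_restrict {a b c d : ℕ} {π : Equiv.Perm (Fin m)}
    (H : IsNCPairingOn p a b π) (hac : a ≤ c) (hdb : d ≤ b)
    (hmaps : ∀ x : Fin m, c ≤ (x : ℕ) → (x : ℕ) < d → c ≤ (π x : ℕ) ∧ (π x : ℕ) < d) :
    ∃ π' : Equiv.Perm (Fin m), IsNCPairingOn p c d π' ∧
      ∀ x : Fin m, c ≤ (x : ℕ) → (x : ℕ) < d → π' x = π x := by
  have hinv : Function.Involutive
      (fun x : Fin m => if c ≤ (x : ℕ) ∧ (x : ℕ) < d then π x else x) := by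
    intro x
    by_cases hx : c ≤ (x : ℕ) ∧ (x : ℕ) < d
    · simp [hx, hmaps x hx.1 hx.2, H.invol]
    · simp [hx]
  have hin : ∀ x : Fin m, c ≤ (x : ℕ) → (x : ℕ) < d → hinv.toPerm _ x = π x := fun x h1 h2 => by
    simp [h1, h2]
  have hout : ∀ x : Fin m, ¬ (c ≤ (x : ℕ) ∧ (x : ℕ) < d) → hinv.toPerm _ x = x := fun x h => by
    simp only [Function.Involutive.coe_toPerm, h, if_false]
  refine ⟨hinv.toPerm _, ⟨hout, fun x h1 h2 => ?_, hinv, fun x h1 h2 => ?_, fun x y h1 h2 => ?_,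
    fun x => ?_⟩, hin⟩
  · rw [hin x h1 h2]; exact hmaps x h1 h2
  · rw [hin x h1 h2]; exact H.ne x (by omega) (by omega)
  · by_cases hx : c ≤ (x : ℕ) ∧ (x : ℕ) < d
    · have := hmaps x hx.1 hx.2
      rw [hin x hx.1 hx.2] at h2 ⊢
      rw [hin y (by omega) (by omega)]
      exact H.nc x y h1 h2
    · rw [hout x hx] at h2; omega
  · by_cases hx : c ≤ (x : ℕ) ∧ (x : ℕ) < d
    · rw [hin x hx.1 hx.2, H.color]
    · rw [hout x hx]

/-- The data of the decomposition of a non-crossing pairing along the block of its first point. -/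
structure IsFirstBlockDecomposition (a b : ℕ) (k : Fin m) (π π₁ π₂ : Equiv.Perm (Fin m)) :
    Prop where
  first : ∀ x : Fin m, (x : ℕ) = a → π x = k
  partner : (π k : ℕ) = a
  inner : ∀ x : Fin m, a + 1 ≤ (x : ℕ) → (x : ℕ) < k → π x = π₁ x
  outer : ∀ x : Fin m, (k : ℕ) + 1 ≤ x → (x : ℕ) < b → π x = π₂ x

variable {a b : ℕ} {k : Fin m} {π π₁ π₂ : Equiv.Perm (Fin m)}

/-- The non-crossing condition for the arc from `a` to `k` confines the points inside it; those to
its right are then confined because `π` is an involution. -/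
lemma exists_firstBlockDecomposition (H : IsNCPairingOn p a b π) (ham : a < m) (hab : a < b)
    (hk : π ⟨a, ham⟩ = k) :
    a < k ∧ (k : ℕ) < b ∧ p k = p ⟨a, ham⟩ ∧ ∃ π₁ π₂, IsNCPairingOn p (a + 1) k π₁ ∧
      IsNCPairingOn p (k + 1) b π₂ ∧ IsFirstBlockDecomposition a b k π π₁ π₂ := by
  have h1 := H.maps ⟨a, ham⟩ le_rfl hab
  have h2 := H.ne ⟨a, ham⟩ le_rfl hab
  have h3 := H.invol ⟨a, ham⟩
  have h4 := H.color ⟨a, ham⟩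
  rw [hk] at h1 h2 h3 h4
  simp only at h1 h2
  have hnc : ∀ x : Fin m, a < (x : ℕ) → (x : ℕ) < k → a < (π x : ℕ) ∧ (π x : ℕ) < k :=
    fun x hx1 hx2 => by
      have := H.nc ⟨a, ham⟩ x hx1 (by rw [hk]; exact hx2)
      rwa [hk] at this
  obtain ⟨π₁, H₁, e₁⟩ := H.exists_restrict (c := a + 1) (d := k) (by omega) (by omega)
    fun x hx1 hx2 => hnc x hx1 hx2
  obtain ⟨π₂, H₂, e₂⟩ := H.exists_restrict (c := k + 1) (d := b) (by omega) le_rfl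
    fun x hx1 hx2 => by
      have hx := H.maps x (by omega) hx2
      have hn := hnc (π x)
      rw [H.invol] at hn
      have i1 : (π x : ℕ) = a → x = k := fun e => by
        rw [← H.invol x, show π x = ⟨a, ham⟩ from Fin.ext e, hk]
      have i2 : (π x : ℕ) = k → (x : ℕ) = a := fun e => by
        rw [← H.invol x, show π x = k from Fin.ext e, h3]
      rw [Fin.ext_iff] at i1
      omega
  exact ⟨by omega, h1.2, h4, π₁, π₂, H₁, H₂, ⟨fun x hx => by rw [← hk]; congr; exact Fin.ext hx,
    by rw [h3], fun x hx1 hx2 => (e₁ x hx1 hx2).symm, fun x hx1 hx2 => (e₂ x hx1 hx2).symm⟩⟩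

lemma exists_isNCPairingOn (ham : a < m) (hak : a < k) (hkb : (k : ℕ) < b) (hp : p k = p ⟨a, ham⟩)
    (H₁ : IsNCPairingOn p (a + 1) k π₁) (H₂ : IsNCPairingOn p (k + 1) b π₂) :
    ∃ π, IsNCPairingOn p a b π ∧ IsFirstBlockDecomposition a b k π π₁ π₂ := by
  set α : Fin m := ⟨a, ham⟩ with hα
  have hα' : (α : ℕ) = a := rfl
  -- The last branch also serves the points outside the interval from `a` to `b`, because `π₂` fixes
  -- them.
  set f : Fin m → Fin m := fun x => if (x : ℕ) = a then k else if x = k then α else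
    if a < (x : ℕ) ∧ (x : ℕ) < k then π₁ x else π₂ x with hf
  have f1 : ∀ x : Fin m, (x : ℕ) = a → f x = k := fun x h => by simp [hf, h]
  have f2 : f k = α := by
    have : (k : ℕ) ≠ a := by omega
    simp [hf, this]
  have f3 : ∀ x : Fin m, a + 1 ≤ (x : ℕ) → (x : ℕ) < k → f x = π₁ x := fun x h1 h2 => by
    have e1 : (x : ℕ) ≠ a := by omega
    have e2 : x ≠ k := fun e => by rw [e] at h2; omega
    have e3 : a < (x : ℕ) := by omega
    simp only [hf, e1, e2, e3, h2, if_false, and_self, if_true]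
  have f4 : ∀ x : Fin m, (k : ℕ) + 1 ≤ x → f x = π₂ x := fun x h1 => by
    have e1 : (x : ℕ) ≠ a := by omega
    have e2 : x ≠ k := fun e => by rw [e] at h1; omega
    have e3 : ¬ (x : ℕ) < k := by omega
    simp only [hf, e1, e2, e3, if_false, and_false]
  have f5 : ∀ x : Fin m, (x : ℕ) < a → f x = x := fun x h1 => by
    have e1 : (x : ℕ) ≠ a := by omega
    have e2 : x ≠ k := fun e => by rw [e] at h1; omega
    have e3 : ¬ a < (x : ℕ) := by omega
    simp only [hf, e1, e2, e3, if_false, false_and]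
    exact H₂.fix x (by omega)
  have cases : ∀ x : Fin m, (x : ℕ) < a ∨ (x : ℕ) = a ∨ (a + 1 ≤ (x : ℕ) ∧ (x : ℕ) < k) ∨ x = k ∨
      ((k : ℕ) + 1 ≤ x ∧ (x : ℕ) < b) ∨ (k + 1 ≤ (x : ℕ) ∧ b ≤ (x : ℕ)) := fun x => by
    rw [Fin.ext_iff]; omega
  have f6 : ∀ x : Fin m, (k : ℕ) + 1 ≤ x → b ≤ (x : ℕ) → f x = x := fun x h1 h2 => by
    rw [f4 x h1]; exact H₂.fix x (by omega)
  have hinv : Function.Involutive f := by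
    intro x
    rcases cases x with h | h | h | rfl | h | h
    · rw [f5 x h, f5 x h]
    · rw [f1 x h, f2]; exact Fin.ext h.symm
    · have := H₁.maps x h.1 h.2
      rw [f3 x h.1 h.2, f3 _ this.1 this.2, H₁.invol]
    · rw [f2, f1 _ rfl]
    · have := H₂.maps x h.1 h.2
      rw [f4 x h.1, f4 _ this.1, H₂.invol]
    · rw [f6 x h.1 h.2, f6 x h.1 h.2]
  refine ⟨hinv.toPerm _, ⟨fun x hx => ?_, fun x h1 h2 => ?_, hinv, fun x h1 h2 => ?_,
    fun x y h1 h2 => ?_, fun x => ?_⟩, ⟨f1, congrArg Fin.val f2, f3, fun x h1 _ => f4 x h1⟩⟩ <;>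
    simp only [Function.Involutive.coe_toPerm] at *
  · rcases lt_or_ge (x : ℕ) a with h | h
    · exact f5 x h
    · exact f6 x (by omega) (by omega)
  · rcases cases x with h | h | h | rfl | h | h
    · omega
    · rw [f1 x h]; omega
    · have := H₁.maps x h.1 h.2
      rw [f3 x h.1 h.2]; omega
    · rw [f2]; omega
    · have := H₂.maps x h.1 h.2
      rw [f4 x h.1]; omega
    · omega
  · rcases cases x with h | h | h | rfl | h | h
    · omega
    · rw [f1 x h]; omega
    · rw [f3 x h.1 h.2]; exact H₁.ne x h.1 h.2
    · rw [f2]; omega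
    · rw [f4 x h.1]; exact H₂.ne x h.1 h.2
    · omega
  · rcases cases x with h | h | h | rfl | h | h
    · rw [f5 x h] at h2; omega
    · rw [f1 x h] at h2 ⊢
      have := H₁.maps y (by omega) h2
      rw [f3 y (by omega) h2]; omega
    · have := H₁.maps x h.1 h.2
      rw [f3 x h.1 h.2] at h2 ⊢
      rw [f3 y (by omega) (by omega)]
      exact H₁.nc x y h1 h2
    · rw [f2] at h2; omega
    · have := H₂.maps x h.1 h.2
      rw [f4 x h.1] at h2 ⊢
      rw [f4 y (by omega)]
      exact H₂.nc x y h1 h2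
    · rw [f6 x h.1 h.2] at h2; omega
  · rcases cases x with h | h | h | rfl | h | h
    · rw [f5 x h]
    · rw [f1 x h, hp]; congr 1; exact Fin.ext h.symm
    · rw [f3 x h.1 h.2, H₁.color]
    · rw [f2, hp]
    · rw [f4 x h.1, H₂.color]
    · rw [f6 x h.1 h.2]

namespace IsFirstBlockDecomposition

lemma left_eq (h : IsFirstBlockDecomposition a b k π π₁ π₂) {π₁' π₂' : Equiv.Perm (Fin m)}
    (h' : IsFirstBlockDecomposition a b k π π₁' π₂')
    (H₁ : IsNCPairingOn p (a + 1) k π₁) (H₁' : IsNCPairingOn p (a + 1) k π₁') : π₁ = π₁' := by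
  ext x
  by_cases hx : a + 1 ≤ (x : ℕ) ∧ (x : ℕ) < k
  · rw [← h.inner x hx.1 hx.2, h'.inner x hx.1 hx.2]
  · rw [H₁.fix x hx, H₁'.fix x hx]

lemma right_eq (h : IsFirstBlockDecomposition a b k π π₁ π₂) {π₁' π₂' : Equiv.Perm (Fin m)}
    (h' : IsFirstBlockDecomposition a b k π π₁' π₂')
    (H₂ : IsNCPairingOn p (k + 1) b π₂) (H₂' : IsNCPairingOn p (k + 1) b π₂') : π₂ = π₂' := by
  ext x
  by_cases hx : (k : ℕ) + 1 ≤ x ∧ (x : ℕ) < b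
  · rw [← h.outer x hx.1 hx.2, h'.outer x hx.1 hx.2]
  · rw [H₂.fix x hx, H₂'.fix x hx]

lemma eq_of (h : IsFirstBlockDecomposition a b k π π₁ π₂) {π' : Equiv.Perm (Fin m)}
    (h' : IsFirstBlockDecomposition a b k π' π₁ π₂)
    (H : IsNCPairingOn p a b π) (H' : IsNCPairingOn p a b π') : π = π' := by
  ext x
  by_cases hx : a ≤ (x : ℕ) ∧ (x : ℕ) < b
  · rcases Nat.lt_trichotomy (x : ℕ) k with hk | hk | hk
    · rcases eq_or_lt_of_le hx.1 with ha | ha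
      · rw [h.first x ha.symm, h'.first x ha.symm]
      · rw [h.inner x ha hk, h'.inner x ha hk]
    · rw [show x = k from Fin.ext hk, h.partner, h'.partner]
    · rw [h.outer x hk hx.2, h'.outer x hk hx.2]
  · rw [H.fix x hx, H'.fix x hx]

/-- The weight is multiplicative along the decomposition; the gaps `a` and `k + 1` get merged. -/
theorem gapWeight_eq (h : IsFirstBlockDecomposition a b k π π₁ π₂) (hak : a < k)
    (hkb : (k : ℕ) < b) (H : IsNCPairingOn p a b π) (H₁ : IsNCPairingOn p (a + 1) k π₁)
    (H₂ : IsNCPairingOn p (k + 1) b π₂) (μ : ℕ → ℂ) (q : ℕ → ℕ) :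
    gapWeight μ q π a b = gapWeight μ q π₁ (a + 1) k *
      gapWeight μ (Function.update q (k + 1) (q (k + 1) + q a)) π₂ (k + 1) b := by
  classical
  have ham : a < m := hak.trans k.2
  have hb : ∀ x : Fin m, a + 1 ≤ (x : ℕ) → (x : ℕ) < k →
      a + 1 ≤ (π x : ℕ) ∧ (π x : ℕ) < k := fun x h1 h2 => by
    rw [h.inner x h1 h2]; exact H₁.maps x h1 h2
  have hc : ∀ x : Fin m, (k : ℕ) + 1 ≤ x → (x : ℕ) < b →
      (k : ℕ) + 1 ≤ π x ∧ (π x : ℕ) < b := fun x h1 h2 => by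
    rw [h.outer x h1 h2]; exact H₂.maps x h1 h2
  have hfirst := h.first ⟨a, ham⟩ rfl
  have r1 : ∀ g ∈ Finset.Icc (a + 1) (k : ℕ), ∀ h' ∈ Finset.Icc (a + 1) (k : ℕ),
      (GapRel π g h' ↔ GapRel π₁ g h') := by
    intro g hg h' hh'
    rw [Finset.mem_Icc] at hg hh'
    refine forall_congr' fun x => ?_
    by_cases hx : a + 1 ≤ (x : ℕ) ∧ (x : ℕ) < k
    · rw [h.inner x hx.1 hx.2]
    · have e1 := hb (π x)
      rw [H.invol] at e1
      rw [H₁.fix x hx]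
      omega
  have r2 : ∀ g ∈ Finset.Icc ((k : ℕ) + 1) b, ∀ h' ∈ Finset.Icc ((k : ℕ) + 1) b,
      (GapRel π g h' ↔ GapRel π₂ g h') := by
    intro g hg h' hh'
    rw [Finset.mem_Icc] at hg hh'
    refine forall_congr' fun x => ?_
    by_cases hx : (k : ℕ) + 1 ≤ x ∧ (x : ℕ) < b
    · rw [h.outer x hx.1 hx.2]
    · have e1 := hc (π x)
      rw [H.invol] at e1
      rw [H₂.fix x hx]
      omega
  have r3 : GapRel π a (k + 1) := GapRel.of_maps H.invol (by omega) fun x hx1 hx2 => by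
    rcases eq_or_lt_of_le hx1 with e | e
    · rw [h.first x e.symm]; omega
    · rcases eq_or_lt_of_le (Nat.lt_succ_iff.1 hx2) with e' | e'
      · rw [show x = k from Fin.ext e', h.partner]; omega
      · have := hb x e e'; omega
  -- The arc separates inner from outer gaps: `k` lies between such gaps, its partner `a` does not.
  have r4 : ∀ g ∈ Finset.Icc (a + 1) (k : ℕ), ∀ h' ∈ Finset.Icc ((k : ℕ) + 1) b,
      ¬ GapRel π g h' := by
    intro g hg h' hh' hr
    rw [Finset.mem_Icc] at hg hh'
    have := hr ⟨a, ham⟩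
    rw [hfirst] at this
    simp only at this
    omega
  have r5 : ∀ g ∈ Finset.Icc (a + 1) (k : ℕ), ¬ GapRel π g a := fun g hg hr =>
    r4 g hg (k + 1) (Finset.mem_Icc.2 ⟨le_rfl, hkb⟩) (hr.trans r3)
  have hsplit : Finset.Icc a b =
      insert a (Finset.Icc (a + 1) (k : ℕ) ∪ Finset.Icc ((k : ℕ) + 1) b) := by
    ext x; simp only [Finset.mem_insert, Finset.mem_union, Finset.mem_Icc]; omega
  have hdisj : Disjoint (Finset.Icc (a + 1) (k : ℕ)) (Finset.Icc ((k : ℕ) + 1) b) := by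
    rw [Finset.disjoint_left]; intro x; simp only [Finset.mem_Icc]; omega
  have hnot : a ∉ Finset.Icc (a + 1) (k : ℕ) ∪ Finset.Icc ((k : ℕ) + 1) b := by
    simp only [Finset.mem_union, Finset.mem_Icc]; omega
  have hall : ∀ Q : ℕ → Prop, (∀ x ∈ Finset.Icc a b, Q x) ↔ Q a ∧
      (∀ x ∈ Finset.Icc (a + 1) (k : ℕ), Q x) ∧ ∀ x ∈ Finset.Icc ((k : ℕ) + 1) b, Q x := fun Q => by
    rw [hsplit]
    simp only [Finset.mem_insert, Finset.mem_union, or_imp, forall_and, forall_eq]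
  have hk1 : (k : ℕ) + 1 ∈ Finset.Icc ((k : ℕ) + 1) b := Finset.mem_Icc.2 ⟨le_rfl, hkb⟩
  unfold gapWeight
  simp only [Finset.prod_filter]
  rw [hsplit, Finset.prod_insert hnot, Finset.prod_union hdisj, ← hsplit]
  -- Gap `a` is not the greatest of its class, which contains `k + 1`. It contributes no factor,
  -- only its exponent `q a`.
  rw [if_neg fun hcon => by
    have := hcon (k + 1) (Finset.mem_Icc.2 (by omega)) r3
    omega, one_mul]
  congr 1
  · refine Finset.prod_congr rfl fun g hg => ?_
    have e1 : (∀ h' ∈ Finset.Icc a b, GapRel π g h' → h' ≤ g) ↔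
        ∀ h' ∈ Finset.Icc (a + 1) (k : ℕ), GapRel π₁ g h' → h' ≤ g := by
      rw [hall]
      constructor
      · rintro ⟨-, h2, -⟩ h' hh' hr
        exact h2 h' hh' ((r1 g hg h' hh').2 hr)
      · intro h2
        exact ⟨fun hr => absurd hr (r5 g hg), fun h' hh' hr => h2 h' hh' ((r1 g hg h' hh').1 hr),
          fun h' hh' hr => absurd hr (r4 g hg h' hh')⟩
    simp only [e1]
    congr 2
    rw [Finset.sum_filter, Finset.sum_filter, hsplit, Finset.sum_insert hnot,
      Finset.sum_union hdisj, if_neg (r5 g hg), zero_add]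
    rw [Finset.sum_eq_zero (s := Finset.Icc ((k : ℕ) + 1) b)
      fun h' hh' => if_neg (r4 g hg h' hh'), add_zero]
    exact Finset.sum_congr rfl fun h' hh' => by simp only [r1 g hg h' hh']
  · refine Finset.prod_congr rfl fun g hg => ?_
    have hag : a ≤ g := by rw [Finset.mem_Icc] at hg; omega
    have e1 : (∀ h' ∈ Finset.Icc a b, GapRel π g h' → h' ≤ g) ↔
        ∀ h' ∈ Finset.Icc ((k : ℕ) + 1) b, GapRel π₂ g h' → h' ≤ g := by
      rw [hall]
      constructor
      · rintro ⟨-, -, h2⟩ h' hh' hr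
        exact h2 h' hh' ((r2 g hg h' hh').2 hr)
      · intro h2
        exact ⟨fun _ => hag, fun h' hh' hr => absurd hr.symm (r4 h' hh' g hg),
          fun h' hh' hr => h2 h' hh' ((r2 g hg h' hh').1 hr)⟩
    simp only [e1]
    congr 2
    rw [Finset.sum_filter, Finset.sum_filter, hsplit, Finset.sum_insert hnot,
      Finset.sum_union hdisj]
    rw [Finset.sum_eq_zero (s := Finset.Icc (a + 1) (k : ℕ))
      fun h' hh' => if_neg fun hr => r4 h' hh' g hg hr.symm, zero_add]
    have e2 : GapRel π g a ↔ GapRel π₂ g (k + 1) :=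
      ⟨fun hr => (r2 g hg _ hk1).1 (hr.trans r3), fun hr => ((r2 g hg _ hk1).2 hr).trans r3.symm⟩
    -- Gap `k + 1` is split off both sums, since the updated exponents differ from `q` only there;
    -- its new exponent includes that of gap `a`.
    rw [← Finset.add_sum_erase _ _ hk1, ← Finset.add_sum_erase _ _ hk1]
    have e3 : ∀ h' ∈ (Finset.Icc ((k : ℕ) + 1) b).erase (k + 1),
        (if GapRel π₂ g h' then Function.update q (k + 1) (q (k + 1) + q a) h' else 0) =
          if GapRel π g h' then q h' else 0 := fun h' hh' => by
      rw [Finset.mem_erase] at hh'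
      rw [Function.update_of_ne hh'.1]
      simp only [r2 g hg h' hh'.2]
    rw [Finset.sum_congr rfl e3]
    simp only [e2, r2 g hg _ hk1, Function.update_self]
    split_ifs <;> ring

end IsFirstBlockDecomposition

/-- The recursion for the weighted sum over the non-crossing pairings of an interval. -/
theorem sum_gapWeight_recursion (p : Fin m → Fin t) (μ : ℕ → ℂ) (q : ℕ → ℕ) (ham : a < m)
    (hab : a < b) :
    ∑ π ∈ ncPairingsOn p a b, gapWeight μ q π a b =
      ∑ k : Fin m, if a < k ∧ (k : ℕ) < b ∧ p k = p ⟨a, ham⟩ then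
        (∑ π₁ ∈ ncPairingsOn p (a + 1) k, gapWeight μ q π₁ (a + 1) k) *
        ∑ π₂ ∈ ncPairingsOn p (k + 1) b,
          gapWeight μ (Function.update q (k + 1) (q (k + 1) + q a)) π₂ (k + 1) b else 0 := by
  classical
  -- The pairings are grouped by the partner `k` of `a`; gluing is a bijection from pairs of an
  -- inner and an outer pairing onto each admissible fibre.
  rw [← Finset.sum_fiberwise (ncPairingsOn p a b) fun π => π ⟨a, ham⟩]
  refine Finset.sum_congr rfl fun k _ => ?_
  split_ifs with hk
  · obtain ⟨hak, hkb, hp⟩ := hk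
    rw [Finset.sum_mul_sum, ← Finset.sum_product']
    have hex : ∀ x ∈ ncPairingsOn p (a + 1) k ×ˢ ncPairingsOn p (k + 1) b,
        ∃ π, IsNCPairingOn p a b π ∧ IsFirstBlockDecomposition a b k π x.1 x.2 := fun x hx => by
      rw [Finset.mem_product, mem_ncPairingsOn, mem_ncPairingsOn] at hx
      exact exists_isNCPairingOn ham hak hkb hp hx.1 hx.2
    choose! F hF1 hF2 using hex
    symm
    refine Finset.sum_nbij F (fun x hx => ?_) (fun x hx y hy hxy => ?_) (fun π hπ => ?_)
      (fun x hx => ?_)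
    · exact Finset.mem_filter.2 ⟨mem_ncPairingsOn.2 (hF1 x hx), (hF2 x hx).first _ rfl⟩
    · have hx' := hx
      have hy' := hy
      have h1 := hF2 x hx
      have h2 := hF2 y hy
      rw [← hxy] at h2
      rw [Finset.mem_coe, Finset.mem_product, mem_ncPairingsOn, mem_ncPairingsOn] at hx' hy'
      exact Prod.ext (h1.left_eq h2 hx'.1 hy'.1) (h1.right_eq h2 hx'.2 hy'.2)
    · rw [Finset.mem_coe, Finset.mem_filter, mem_ncPairingsOn] at hπ
      obtain ⟨-, -, -, π₁, π₂, H₁, H₂, hd⟩ :=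
        exists_firstBlockDecomposition hπ.1 ham hab hπ.2
      have hmem : (π₁, π₂) ∈ ncPairingsOn p (a + 1) k ×ˢ ncPairingsOn p (k + 1) b := by
        rw [Finset.mem_product, mem_ncPairingsOn, mem_ncPairingsOn]; exact ⟨H₁, H₂⟩
      exact ⟨(π₁, π₂), hmem, (hF2 _ hmem).eq_of hd (hF1 _ hmem) hπ.1⟩
    · have hx' := hx
      rw [Finset.mem_product, mem_ncPairingsOn, mem_ncPairingsOn] at hx'
      exact ((hF2 x hx).gapWeight_eq hak hkb (hF1 x hx) hx'.1 hx'.2 μ q).symm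
  · refine Finset.sum_eq_zero fun π hπ => absurd ?_ hk
    rw [Finset.mem_filter, mem_ncPairingsOn] at hπ
    obtain ⟨h1, h2, h3, -⟩ := exists_firstBlockDecomposition hπ.1 ham hab hπ.2
    exact ⟨h1, h2, h3⟩

end Weights

/-! ### Words with prescribed gaps -/

section GapWord

variable {m t : ℕ}

/-- The word with letters `c a, …, c (a + n - 1)`, with `q g` letters `inr ()` in gap `g`. -/
def gapWord (c : ℕ → Fin t ⊕ Unit) (q : ℕ → ℕ) : ℕ → ℕ → List (Fin t ⊕ Unit)
  | a, 0 => List.replicate (q a) (.inr ())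
  | a, n + 1 => List.replicate (q a) (.inr ()) ++ c a :: gapWord c q (a + 1) n

lemma gapWord_congr (c : ℕ → Fin t ⊕ Unit) {q q' : ℕ → ℕ} {a : ℕ} (n : ℕ)
    (h : ∀ g, a ≤ g → q g = q' g) : gapWord c q a n = gapWord c q' a n := by
  induction n generalizing a with
  | zero => simp [gapWord, h a le_rfl]
  | succ n ih =>
    have := ih (a := a + 1) fun g hg => h g (by omega)
    simp [gapWord, h a le_rfl, this]

lemma replicate_append_gapWord (c : ℕ → Fin t ⊕ Unit) (q : ℕ → ℕ) (a n s : ℕ) :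
    List.replicate s (.inr ()) ++ gapWord c q a n =
      gapWord c (Function.update q a (q a + s)) a n := by
  cases n with
  | zero => simp [gapWord, add_comm]
  | succ n =>
    simp only [gapWord, ← List.append_assoc, List.replicate_append_replicate,
      Function.update_self, add_comm s]
    have h : ∀ g, a + 1 ≤ g → Function.update q a (q a + s) g = q g := fun g hg =>
      Function.update_of_ne (by omega) _ _
    rw [gapWord_congr c n h]

lemma splits_replicate_inr (r : Fin t) (s : ℕ) :
    splits (.inl r) (List.replicate s (.inr () : Fin t ⊕ Unit)) = [] := by
  induction s with
  | zero => rfl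
  | succ s ih => simp [List.replicate_succ, splits, ih]

lemma sum_map_splits_gapWord {M : Type*} [AddCommMonoid M] (c : ℕ → Fin t ⊕ Unit) (q : ℕ → ℕ)
    (r : Fin t) (a n : ℕ) (F : List (Fin t ⊕ Unit) × List (Fin t ⊕ Unit) → M) :
    ((splits (.inl r) (gapWord c q a n)).map F).sum = ∑ j ∈ Finset.range n,
      if c (a + j) = .inl r then F (gapWord c q a j, gapWord c q (a + j + 1) (n - 1 - j)) else 0 := by
  induction n generalizing a F with
  | zero => simp [gapWord, splits_replicate_inr]
  | succ n ih =>
    rw [gapWord, splits_append, splits_replicate_inr, List.map_nil, List.nil_append, splits,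
      List.map_append, List.map_append, List.sum_append, List.map_map, List.map_map, List.map_map,
      ih, Finset.sum_range_succ', add_comm]
    congr 1
    · refine Finset.sum_congr rfl fun j _ => ?_
      simp only [Function.comp, gapWord]
      rw [show a + 1 + j = a + (j + 1) by ring, show n + 1 - 1 - (j + 1) = n - 1 - j by omega]
    · by_cases h : c a = .inl r <;> simp [h, gapWord]

lemma prod_map_gapWord {M : Type*} [Monoid M] (f : Fin t ⊕ Unit → M) (c : ℕ → Fin t ⊕ Unit)
    (q : ℕ → ℕ) (a n : ℕ) :
    ((gapWord c q a n).map f).prod = f (.inr ()) ^ q a *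
      (List.ofFn fun j : Fin n => f (c (a + j)) * f (.inr ()) ^ q (a + j + 1)).prod := by
  induction n generalizing a with
  | zero => simp [gapWord]
  | succ n ih =>
    simp only [gapWord, List.map_append, List.map_cons, List.prod_append, List.prod_cons, ih,
      List.ofFn_succ, List.map_replicate, List.prod_replicate, Fin.val_zero, add_zero,
      Fin.val_succ, mul_assoc, Nat.add_assoc, Nat.add_comm, Nat.add_left_comm]

/-- A loop functional is a sum over non-crossing pairings. -/
theorem IsLoopFunctional.sum_gapWeight {μ : ℕ → ℂ} {ℓ : List (Fin t ⊕ Unit) → ℂ}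
    (hℓ : IsLoopFunctional μ ℓ) (p : Fin m → Fin t) (c : ℕ → Fin t ⊕ Unit)
    (hc : ∀ x : Fin m, c x = .inl (p x)) (n : ℕ) :
    ∀ (a b : ℕ) (q : ℕ → ℕ), a + n = b → b ≤ m →
      ∑ π ∈ ncPairingsOn p a b, gapWeight μ q π a b = ℓ (gapWord c q a n) := by
  induction n using Nat.strong_induction_on with
  | _ n ih =>
  intro a b q hab hbm
  rcases n with _ | n
  · obtain rfl : a = b := by omega
    have : ncPairingsOn p a a = {1} := by
      ext π
      rw [mem_ncPairingsOn, Finset.mem_singleton]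
      exact ⟨fun H => H.eq_one, fun h => h ▸ isNCPairingOn_one p a⟩
    rw [this, Finset.sum_singleton, gapWeight_self, gapWord, hℓ.moments]
  · have ham : a < m := by omega
    have hca : c a = .inl (p ⟨a, ham⟩) := hc ⟨a, ham⟩
    set r := p ⟨a, ham⟩ with hr
    rw [sum_gapWeight_recursion p μ q ham (by omega)]
    have e1 : ∀ k : Fin m, p k = p ⟨a, ham⟩ ↔ c k = .inl r := fun k => by
      rw [hc k, Sum.inl.injEq]
    simp only [e1]
    rw [Fin.sum_univ_eq_sum_range (fun k => if a < k ∧ k < b ∧ c k = .inl r then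
        (∑ π₁ ∈ ncPairingsOn p (a + 1) k, gapWeight μ q π₁ (a + 1) k) *
        ∑ π₂ ∈ ncPairingsOn p (k + 1) b,
          gapWeight μ (Function.update q (k + 1) (q (k + 1) + q a)) π₂ (k + 1) b else 0) m]
    rw [← Finset.sum_subset (s₁ := Finset.Ico (a + 1) b) (fun k hk => by
        rw [Finset.mem_Ico] at hk; rw [Finset.mem_range]; omega) (fun k _ hk => if_neg (by
        rw [Finset.mem_Ico] at hk; omega)), Finset.sum_Ico_eq_sum_range]
    -- Traciality moves the `q a` letters of gap `a` to the end of the word, so that the letter of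
    -- point `a` comes first and the loop equation applies.
    rw [gapWord, hℓ.cyclic, List.cons_append, hca, hℓ.loop, splits_append, splits_replicate_inr,
      List.map_nil, List.append_nil, List.map_map, sum_map_splits_gapWord,
      show b - (a + 1) = n by omega]
    refine Finset.sum_congr rfl fun j hj => ?_
    rw [Finset.mem_range] at hj
    have e2 : (a < a + 1 + j ∧ a + 1 + j < b ∧ c (a + 1 + j) = .inl r) ↔
        c (a + 1 + j) = .inl r :=
      ⟨fun h => h.2.2, fun h => ⟨by omega, by omega, h⟩⟩
    simp only [e2, Function.comp]
    split_ifs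
    -- A second rotation, of the outer word, brings these `q a` letters to its front, that is into
    -- gap `k + 1`: this is the update of `q` in the recursion.
    · rw [ih j (by omega) (a + 1) (a + 1 + j) q rfl (by omega),
        ih (n - 1 - j) (by omega) (a + 1 + j + 1) b _ (by omega) hbm, hℓ.cyclic (gapWord _ _ _ _),
        replicate_append_gapWord]
    · rfl

end GapWord

/-! ### The moments along a permutation -/

section MomentAlong

lemma prod_eq_prod_quotient {ι M : Type*} [Fintype ι] [CommMonoid M] (r : Setoid ι)
    [Fintype (Quotient r)] (F : Quotient r → M) (s : Finset ι) (hs : ∀ x, ∃ i ∈ s, r x i)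
    (hs' : ∀ i ∈ s, ∀ j ∈ s, r i j → i = j) : ∏ i ∈ s, F ⟦i⟧ = ∏ c, F c := by
  refine Finset.prod_nbij (fun i => ⟦i⟧) (fun _ _ => Finset.mem_univ _)
    (fun i hi j hj h => hs' i hi j hj (Quotient.exact h)) (fun c _ => ?_) fun _ _ => rfl
  induction c using Quotient.inductionOn with
  | h x =>
    obtain ⟨i, hi, h⟩ := hs x
    exact ⟨i, hi, Quotient.sound (r.symm h)⟩

open Classical in
/-- A product over the least elements of the classes is the product over the greatest ones. -/
lemma prod_least_eq_prod_greatest {m : ℕ} {M : Type*} [CommMonoid M] {R : Fin m → Fin m → Prop}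
    (hR : Equivalence R) (F : Fin m → M) (hF : ∀ i j, R i j → F i = F j) :
    ∏ i : Fin m with (∀ j, R i j → i ≤ j), F i = ∏ i : Fin m with (∀ j, R i j → j ≤ i), F i := by
  let r : Setoid (Fin m) := ⟨R, hR⟩
  let F' : Quotient r → M := Quotient.lift F hF
  have h1 := prod_eq_prod_quotient r F' {i : Fin m | ∀ j, R i j → i ≤ j} (fun x => by
      obtain ⟨i, hi, h⟩ := Finset.exists_min_image (Finset.univ.filter (R x)) id
        ⟨x, by simp [hR.refl x]⟩
      simp only [Finset.mem_filter, Finset.mem_univ, true_and, id] at hi h ⊢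
      exact ⟨i, fun j hj => h j (hR.trans hi hj), hi⟩) (fun i hi j hj h => by
      simp only [Finset.mem_filter, Finset.mem_univ, true_and] at hi hj
      exact le_antisymm (hi j h) (hj i (hR.symm h)))
  have h2 := prod_eq_prod_quotient r F' {i : Fin m | ∀ j, R i j → j ≤ i} (fun x => by
      obtain ⟨i, hi, h⟩ := Finset.exists_max_image (Finset.univ.filter (R x)) id
        ⟨x, by simp [hR.refl x]⟩
      simp only [Finset.mem_filter, Finset.mem_univ, true_and, id] at hi h ⊢
      exact ⟨i, fun j hj => h j (hR.trans hi hj), hi⟩) (fun i hi j hj h => by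
      simp only [Finset.mem_filter, Finset.mem_univ, true_and] at hi hj
      exact le_antisymm (hj i (hR.symm h)) (hi j h))
  exact h1.trans h2.symm

open Classical in
lemma sum_minimalPeriod {m : ℕ} (σ : Equiv.Perm (Fin m)) (i : Fin m) (q : Fin m → ℕ) :
    ∑ k : Fin (Function.minimalPeriod σ i), q ((σ ^ (k : ℕ)) i) =
      ∑ j : Fin m with σ.SameCycle i j, q j := by
  have hpow : ∀ n, (σ ^ n) i = σ^[n] i := fun n => by rw [Equiv.Perm.iterate_eq_pow]
  have hpos : 0 < Function.minimalPeriod σ i :=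
    Function.minimalPeriod_pos_of_mem_periodicPts (σ.injective.mem_periodicPts i)
  refine Finset.sum_nbij (fun k => (σ ^ (k : ℕ)) i) (fun k _ => ?_) (fun k _ l _ h => ?_)
    (fun j hj => ?_) fun _ _ => rfl
  · simp only [Finset.mem_filter, Finset.mem_univ, true_and]
    exact Equiv.Perm.sameCycle_pow_right.2 (.refl _ _)
  · simp only [hpow] at h
    exact Fin.ext (Function.iterate_injOn_Iio_minimalPeriod k.2 l.2 h)
  · simp only [Finset.coe_filter, Finset.mem_univ, true_and, Set.mem_ofPred_eq] at hj
    obtain ⟨n, rfl⟩ := hj.exists_nat_pow_eq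
    refine ⟨⟨n % Function.minimalPeriod σ i, Nat.mod_lt _ hpos⟩, by simp, ?_⟩
    simp only [hpow, Function.iterate_mod_minimalPeriod_eq]

lemma prod_ofFn_pow {M : Type*} [Monoid M] (d : M) (n : ℕ) (f : Fin n → ℕ) :
    (List.ofFn fun k => d ^ f k).prod = d ^ ∑ k, f k := by
  induction n with
  | zero => simp
  | succ n ih => rw [List.ofFn_succ, List.prod_cons, ih, Fin.sum_univ_succ, pow_add]

open Classical in
-- All arguments are powers of one element, so a factor depends only on the sum of the exponents
-- over the orbit, and any representative will do. The greatest one agrees with the convention of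
-- `gapWeight`.
lemma momentAlong_pow (𝒜 : NCProbSpace.{u}) {m : ℕ} (σ : Equiv.Perm (Fin m)) (d : 𝒜)
    (q : Fin m → ℕ) :
    momentAlong 𝒜 σ (fun j => d ^ q j) =
      ∏ i : Fin m with (∀ j, σ.SameCycle i j → j ≤ i),
        𝒜.φ (d ^ ∑ j : Fin m with σ.SameCycle i j, q j) := by
  have h := prod_least_eq_prod_greatest (R := σ.SameCycle)
    ⟨.refl σ, .symm, .trans⟩ (fun i => 𝒜.φ (d ^ ∑ j : Fin m with σ.SameCycle i j, q j)) fun i j (h : σ.SameCycle i j) => by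
      have : ∀ k, σ.SameCycle i k ↔ σ.SameCycle j k := fun k => ⟨h.symm.trans, h.trans⟩
      simp only [this]
  refine Eq.trans ?_ (h.trans (Finset.prod_congr (by congr!) fun _ _ => rfl))
  unfold momentAlong
  refine Finset.prod_congr (by congr!) fun i _ => ?_
  rw [prod_ofFn_pow d _ fun k : Fin (Function.minimalPeriod σ i) => q ((σ ^ (k : ℕ)) i),
    sum_minimalPeriod]

/-- Exponents indexed by points, as exponents indexed by the gaps that follow them. -/
def gapExponent {m : ℕ} (q : Fin m → ℕ) : ℕ → ℕ
  | 0 => 0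
  | g + 1 => if h : g < m then q ⟨g, h⟩ else 0

lemma gapExponent_succ {m : ℕ} (q : Fin m → ℕ) (j : Fin m) : gapExponent q (j + 1) = q j := by
  simp [gapExponent]

/-- Point `i` corresponds to gap `i + 1`. The additional gap 0 has exponent 0; for `m > 0` it is
related to gap `m`, hence never greatest in its class, and gives no factor. For `m = 0` it is the
only gap, with factor `φ 1 = 1`. -/
theorem momentAlong_eq_gapWeight (𝒜 : NCProbSpace.{u}) (d : 𝒜) {m t : ℕ} {p : Fin m → Fin t}
    {π : Equiv.Perm (Fin m)} (H : IsNCPairingOn p 0 m π) (q : Fin m → ℕ) :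
    momentAlong 𝒜 (π * finRotate m) (fun j => d ^ q j) =
      gapWeight (fun k => 𝒜.φ (d ^ k)) (gapExponent q) π 0 m := by
  classical
  rcases Nat.eq_zero_or_pos m with rfl | hm
  · simp [momentAlong, gapWeight_self, gapExponent, 𝒜.φ_one]
  have hIcc : Finset.Icc 0 m = insert 0 (Finset.univ.image fun i : Fin m => (i : ℕ) + 1) := by
    ext g
    simp only [Finset.mem_Icc, Finset.mem_insert, Finset.mem_image, Finset.mem_univ, true_and]
    constructor
    · intro h
      rcases g with _ | g
      · exact .inl rfl
      · exact .inr ⟨⟨g, by omega⟩, rfl⟩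
    · rintro (rfl | ⟨i, rfl⟩) <;> omega
  have hinj : Set.InjOn (fun i : Fin m => (i : ℕ) + 1) (Finset.univ : Finset (Fin m)) :=
    fun i _ j _ h => Fin.ext (by simpa using h)
  have h0 : (0 : ℕ) ∉ Finset.univ.image fun i : Fin m => (i : ℕ) + 1 := by simp
  rw [momentAlong_pow, gapWeight]
  simp only [Finset.prod_filter, Finset.sum_filter, H.sameCycle_iff]
  have e1 : ∀ g, (∀ h ∈ Finset.Icc 0 m, GapRel π g h → h ≤ g) ↔
      ∀ j : Fin m, GapRel π g (j + 1) → (j : ℕ) + 1 ≤ g := fun g => by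
    rw [hIcc]
    simp only [Finset.mem_insert, Finset.mem_image, Finset.mem_univ, true_and, or_imp,
      forall_and, forall_eq, forall_exists_index, forall_apply_eq_imp_iff, zero_le, imp_true_iff]
  have e2 : ∀ g, (∑ h ∈ Finset.Icc 0 m, if GapRel π g h then gapExponent q h else 0) =
      ∑ j : Fin m, if GapRel π g (j + 1) then q j else 0 := fun g => by
    rw [hIcc, Finset.sum_insert h0, Finset.sum_image hinj]
    simp [gapExponent]
  simp only [e1, e2]
  rw [hIcc, Finset.prod_insert h0, Finset.prod_image hinj, if_neg fun h => by
    have := h ⟨m - 1, by omega⟩ (by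
      rw [show m - 1 + 1 = m by omega]; exact GapRel.zero_top π)
    simp at this, one_mul]
  refine Finset.prod_congr rfl fun i _ => ?_
  simp only [Nat.add_le_add_iff_right, Fin.val_fin_le]

end MomentAlong

/-! ### Free families -/

section Freeness

open Polynomial

variable (𝒜 : NCProbSpace.{u}) {ι : Type*}

/-- The product of the polynomials `P` in the variables `x i`, over the list of the `(i, P)`. -/
noncomputable def polyProd {𝒜 : NCProbSpace.{u}} {ι : Type*} (x : ι → 𝒜) (l : List (ι × ℂ[X])) : 𝒜 :=
  (l.map fun y => aeval (x y.1) y.2).prod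

/-- Neighbours in the list belong to different variables. -/
def IsAlternating {ι : Type*} (l : List (ι × ℂ[X])) : Prop := l.IsChain fun y z => y.1 ≠ z.1

/-- All the polynomials in the list are centered. -/
def IsCentered {𝒜 : NCProbSpace.{u}} {ι : Type*} (x : ι → 𝒜) (l : List (ι × ℂ[X])) : Prop :=
  ∀ y ∈ l, 𝒜.φ (aeval (x y.1) y.2) = 0

variable {𝒜} {x : ι → 𝒜}

@[simp] lemma polyProd_nil : polyProd x [] = 1 := rfl

@[simp] lemma polyProd_cons (y : ι × ℂ[X]) (l : List (ι × ℂ[X])) :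
    polyProd x (y :: l) = aeval (x y.1) y.2 * polyProd x l := by
  simp [polyProd]

@[simp] lemma polyProd_append (l l' : List (ι × ℂ[X])) :
    polyProd x (l ++ l') = polyProd x l * polyProd x l' := by
  simp [polyProd]

lemma φ_algebraMap (c : ℂ) : 𝒜.φ (algebraMap ℂ 𝒜 c) = c := by
  rw [Algebra.algebraMap_eq_smul_one, map_smul, 𝒜.φ_one, smul_eq_mul, mul_one]

lemma φ_aeval_sub_C (a : 𝒜) (P : ℂ[X]) :
    𝒜.φ (aeval a (P - C (𝒜.φ (aeval a P)))) = 0 := by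
  rw [map_sub, map_sub, aeval_C, φ_algebraMap, sub_self]

/-- The unital algebra generated by one element consists of the polynomials in it. Lists of
polynomials can be merged, centered and measured by degree, which is what the later inductions need.
-/
theorem freeVariables_iff : FreeVariables 𝒜 x ↔ ∀ l : List (ι × ℂ[X]), l ≠ [] →
    IsAlternating l → IsCentered x l → 𝒜.φ (polyProd x l) = 0 := by
  constructor
  · intro h l hl halt hcen
    have := h l.length (List.length_pos_iff.2 hl) (fun j => (l.get j).1)
      (fun j => aeval (x (l.get j).1) (l.get j).2)
      (fun j => by
        simp only [Algebra.adjoin_singleton_eq_range_aeval]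
        exact ⟨_, rfl⟩)
      (fun j j' hj => by
        have := List.isChain_iff_getElem.1 halt j (by omega)
        simp only [List.get_eq_getElem]
        convert this using 3
        exact hj.symm)
      (fun j => hcen _ (List.get_mem l j))
    have e : (List.ofFn fun j => aeval (x (l.get j).1) (l.get j).2) =
        l.map fun y => aeval (x y.1) y.2 := by
      conv_rhs => rw [← List.ofFn_get l, List.map_ofFn]
      rfl
    rwa [e] at this
  · intro h k hk i a ha hi hφ
    have : ∀ j, ∃ P : ℂ[X], aeval (x (i j)) P = a j := fun j => by
      have := ha j
      simp only [Algebra.adjoin_singleton_eq_range_aeval] at this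
      exact this
    choose P hP using this
    have key := h (List.ofFn fun j => (i j, P j)) (by
        intro h0
        have := congrArg List.length h0
        simp at this
        omega)
      (List.isChain_iff_getElem.2 fun j hj => by
        simp only [List.getElem_ofFn]
        exact hi _ _ rfl)
      (fun y hy => by
        obtain ⟨j, rfl⟩ := List.mem_ofFn.1 hy
        simp only [hP, hφ])
    simpa [polyProd, List.map_ofFn, Function.comp_def, hP] using key

lemma φ_aeval_eq_of_moments {ℬ : NCProbSpace.{v}} {a : 𝒜} {b : ℬ}
    (h : ∀ k : ℕ, 𝒜.φ (a ^ k) = ℬ.φ (b ^ k)) (P : ℂ[X]) : 𝒜.φ (aeval a P) = ℬ.φ (aeval b P) := by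
  rw [aeval_eq_sum_range, aeval_eq_sum_range, map_sum, map_sum]
  simp [h]

/-- The joint distribution of a free family is determined by the individual distributions. -/
theorem FreeVariables.φ_polyProd_eq {ℬ : NCProbSpace.{v}} {y : ι → ℬ} (hx : FreeVariables 𝒜 x)
    (hy : FreeVariables ℬ y) (hxy : ∀ i, ∀ k : ℕ, 𝒜.φ (x i ^ k) = ℬ.φ (y i ^ k)) (n : ℕ) :
    ∀ l : List (ι × ℂ[X]), l.length = n → 𝒜.φ (polyProd x l) = ℬ.φ (polyProd y l) := by
  rw [freeVariables_iff] at hx hy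
  have hmom := fun i P => φ_aeval_eq_of_moments (hxy i) P
  induction n using Nat.strong_induction_on with
  | _ n ih =>
  -- The prefix `M` is already centered. Centering the next polynomial leaves a multiple of the
  -- shorter product over `M ++ L`, which the induction on the length covers even if it is no longer
  -- alternating.
  have key : ∀ L M : List (ι × ℂ[X]), (M ++ L).length = n → IsAlternating (M ++ L) →
      IsCentered x M → 𝒜.φ (polyProd x (M ++ L)) = ℬ.φ (polyProd y (M ++ L)) := by
    intro L
    induction L with
    | nil =>
      intro M _ halt hcen
      rw [List.append_nil] at halt ⊢
      rcases eq_or_ne M [] with rfl | hM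
      · simp [𝒜.φ_one, ℬ.φ_one]
      · rw [hx M hM halt hcen, hy M hM halt fun z hz => by rw [← hmom]; exact hcen z hz]
    | cons z L ihL =>
      obtain ⟨i, P⟩ := z
      intro M hn halt hcen
      set c := 𝒜.φ (aeval (x i) P) with hc
      have hP : P = (P - C c) + C c := by ring
      have e1 : polyProd x (M ++ (i, P) :: L) =
          polyProd x ((M ++ [(i, P - C c)]) ++ L) + c • polyProd x (M ++ L) := by
        simp [Algebra.algebraMap_eq_smul_one, sub_mul, mul_sub]
      have e2 : polyProd y (M ++ (i, P) :: L) =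
          polyProd y ((M ++ [(i, P - C c)]) ++ L) + c • polyProd y (M ++ L) := by
        simp [Algebra.algebraMap_eq_smul_one, sub_mul, mul_sub]
      have h1 := ihL (M ++ [(i, P - C c)]) (by simpa using hn) (by
        simp only [IsAlternating, List.append_assoc, List.singleton_append] at halt ⊢
        simp only [List.isChain_append, List.isChain_cons, List.head?_cons, Option.mem_def,
          Option.some.injEq, forall_eq'] at halt ⊢
        exact halt) (by
        intro z hz
        rcases List.mem_append.1 hz with hz | hz
        · exact hcen z hz
        · rw [List.mem_singleton.1 hz]
          exact φ_aeval_sub_C _ _)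
      have h2 := ih (M ++ L).length (by simp at hn ⊢; omega) (M ++ L) rfl
      rw [e1, e2, map_add, map_add, map_smul, map_smul, h1, h2]
  intro l hl
  by_cases halt : IsAlternating l
  · exact key l [] (by simpa using hl) halt fun z hz => by simp at hz
  -- Two neighbours in the same variable multiply to a single polynomial, which shortens the list.
  -- The identities `e` and `e'` differ only in the universe of the space.
  · obtain ⟨L₁, z, w, L₂, rfl, hzw⟩ : ∃ L₁ z w L₂, l = L₁ ++ z :: w :: L₂ ∧ z.1 = w.1 := by
      by_contra! hcon
      exact halt (List.isChain_iff_forall_rel_of_append_cons_cons.2 fun a b l₁ l₂ h =>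
        hcon l₁ a b l₂ h)
    have e : ∀ {𝒞 : NCProbSpace.{u}} (x : ι → 𝒞), polyProd x (L₁ ++ z :: w :: L₂) =
        polyProd x (L₁ ++ (z.1, z.2 * w.2) :: L₂) := fun x => by simp [hzw, mul_assoc]
    have e' : ∀ {𝒞 : NCProbSpace.{v}} (x : ι → 𝒞), polyProd x (L₁ ++ z :: w :: L₂) =
        polyProd x (L₁ ++ (z.1, z.2 * w.2) :: L₂) := fun x => by simp [hzw, mul_assoc]
    rw [e, e']
    exact ih _ (by simp at hl ⊢; omega) _ rfl

theorem FreeVariables.φ_word_eq {ℬ : NCProbSpace.{v}} {y : ι → ℬ} (hx : FreeVariables 𝒜 x)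
    (hy : FreeVariables ℬ y) (hxy : ∀ i, ∀ k : ℕ, 𝒜.φ (x i ^ k) = ℬ.φ (y i ^ k)) (w : List ι) :
    𝒜.φ (w.map x).prod = ℬ.φ (w.map y).prod := by
  have := hx.φ_polyProd_eq hy hxy _ (w.map fun i => (i, X)) rfl
  simpa [polyProd, Function.comp_def] using this

/-- A distribution with the moments of the standard semicircular law. -/
lemma HasStandardSemicircularLaw.moments_eq {ℬ : NCProbSpace.{v}} {a : 𝒜} {b : ℬ}
    (ha : HasStandardSemicircularLaw 𝒜 a) (hb : HasStandardSemicircularLaw ℬ b) (k : ℕ) :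
    𝒜.φ (a ^ k) = ℬ.φ (b ^ k) := by
  rcases Nat.even_or_odd' k with ⟨n, rfl | rfl⟩
  · rw [(ha n).1, (hb n).1]
  · rw [(ha n).2, (hb n).2]

end Freeness

/-! ### Freeness from the loop equation -/

section LoopFreeness

open Polynomial

/-- The tracial loop equation for the variables `x (inl r)`, in terms of the functionals
`E r a b = (φ ⊗ φ)((a ⊗ 1) ∂_r(·) (1 ⊗ b))` built from the free difference quotients `∂_r`. -/
structure SatisfiesLoopEquation {𝒜 : NCProbSpace.{u}} {t : ℕ} (x : Fin t ⊕ Unit → 𝒜)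
    (E : Fin t → 𝒜 → 𝒜 → 𝒜 →ₗ[ℂ] ℂ) : Prop where
  cyclic : ∀ a b, 𝒜.φ (a * b) = 𝒜.φ (b * a)
  loop : ∀ r a, 𝒜.φ (x (.inl r) * a) = E r 1 1 a
  leibniz : ∀ r a b c d, E r a b (c * d) = E r a (d * b) c + E r (a * c) b d
  self : ∀ r a b, E r a b (x (.inl r)) = 𝒜.φ a * 𝒜.φ b
  other : ∀ r a b i, i ≠ .inl r → E r a b (x i) = 0

/-- The degree in the variables `inl _`. -/
noncomputable def leftDegree {t : ℕ} (l : List ((Fin t ⊕ Unit) × ℂ[X])) : ℕ :=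
  (l.map fun y => if y.1.isLeft then y.2.natDegree else 0).sum

@[simp] lemma leftDegree_nil {t : ℕ} : leftDegree ([] : List ((Fin t ⊕ Unit) × ℂ[X])) = 0 := rfl

@[simp] lemma leftDegree_cons {t : ℕ} (y : (Fin t ⊕ Unit) × ℂ[X]) (l) :
    leftDegree (y :: l) = (if y.1.isLeft then y.2.natDegree else 0) + leftDegree l := by
  simp [leftDegree]

@[simp] lemma leftDegree_append {t : ℕ} (l l' : List ((Fin t ⊕ Unit) × ℂ[X])) :
    leftDegree (l ++ l') = leftDegree l + leftDegree l' := by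
  simp [leftDegree]

namespace SatisfiesLoopEquation

variable {𝒜 : NCProbSpace.{u}} {t : ℕ} {x : Fin t ⊕ Unit → 𝒜}
  {E : Fin t → 𝒜 → 𝒜 → 𝒜 →ₗ[ℂ] ℂ}

lemma map_one (h : SatisfiesLoopEquation x E) (r : Fin t) (a b : 𝒜) : E r a b 1 = 0 := by
  have := h.leibniz r a b 1 1
  simpa using this

lemma map_pow (h : SatisfiesLoopEquation x E) (r : Fin t) (a b : 𝒜) (n : ℕ) :
    E r a b (x (.inl r) ^ n) = ∑ l ∈ Finset.range n,
      𝒜.φ (a * x (.inl r) ^ l) * 𝒜.φ (x (.inl r) ^ (n - 1 - l) * b) := by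
  induction n generalizing a with
  | zero => simp [h.map_one]
  | succ n ih =>
    rw [pow_succ', h.leibniz, h.self, ih, Finset.sum_range_succ', add_comm]
    congr 1
    · refine Finset.sum_congr rfl fun l _ => ?_
      rw [pow_succ', mul_assoc, show n + 1 - 1 - (l + 1) = n - 1 - l by omega]
    · simp

/-- By `map_pow`, every term of the difference quotient of `P` carries a factor `φ(a x^l)` with `l <
deg P`. -/
lemma map_aeval_eq_zero (h : SatisfiesLoopEquation x E) (r : Fin t) (a b : 𝒜) (P : ℂ[X])
    (hP : ∀ l < P.natDegree, 𝒜.φ (a * x (.inl r) ^ l) = 0) :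
    E r a b (aeval (x (.inl r)) P) = 0 := by
  rw [aeval_eq_sum_range, map_sum]
  refine Finset.sum_eq_zero fun i hi => ?_
  rw [Finset.mem_range] at hi
  rw [map_smul, h.map_pow, Finset.sum_eq_zero, smul_zero]
  intro l hl
  rw [Finset.mem_range] at hl
  rw [hP l (by omega), zero_mul]

lemma map_aeval_eq_zero' (h : SatisfiesLoopEquation x E) (r : Fin t) (a b : 𝒜) (P : ℂ[X])
    (hP : ∀ l < P.natDegree, 𝒜.φ (x (.inl r) ^ l * b) = 0) :
    E r a b (aeval (x (.inl r)) P) = 0 := by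
  rw [aeval_eq_sum_range, map_sum]
  refine Finset.sum_eq_zero fun i hi => ?_
  rw [Finset.mem_range] at hi
  rw [map_smul, h.map_pow, Finset.sum_eq_zero, smul_zero]
  intro l hl
  rw [Finset.mem_range] at hl
  rw [hP (i - 1 - l) (by omega), mul_zero]

lemma map_aeval_other (h : SatisfiesLoopEquation x E) (r : Fin t) (a b : 𝒜) (P : ℂ[X])
    {i : Fin t ⊕ Unit} (hi : i ≠ .inl r) : E r a b (aeval (x i) P) = 0 := by
  have hpow : ∀ n a, E r a b (x i ^ n) = 0 := by
    intro n
    induction n with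
    | zero => intro a; rw [pow_zero, h.map_one]
    | succ n ih =>
      intro a
      rw [pow_succ', h.leibniz, h.other r _ _ i hi, ih, add_zero]
  rw [aeval_eq_sum_range, map_sum]
  simp [hpow]

/-- The moments of alternating centered products of degree less than `n` vanish. -/
def VanishesBelow (x : Fin t ⊕ Unit → 𝒜) (n : ℕ) : Prop :=
  ∀ l : List ((Fin t ⊕ Unit) × ℂ[X]), l ≠ [] → IsAlternating l → IsCentered x l →
    leftDegree l < n → 𝒜.φ (polyProd x l) = 0

lemma _root_.IsCentered.append {l l' : List ((Fin t ⊕ Unit) × ℂ[X])} (hl : IsCentered x l)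
    (hl' : IsCentered x l') : IsCentered x (l ++ l') := fun y hy =>
  (List.mem_append.1 hy).elim (hl y) (hl' y)

lemma isCentered_singleton (x : Fin t ⊕ Unit → 𝒜) (i : Fin t ⊕ Unit) (P : ℂ[X]) :
    IsCentered x [(i, P - C (𝒜.φ (aeval (x i) P)))] := fun y hy => by
  rw [List.mem_singleton.1 hy]
  exact φ_aeval_sub_C _ _

lemma aeval_eq_sub_C_add (a : 𝒜) (P : ℂ[X]) (c : ℂ) :
    aeval a P = aeval a (P - C c) + c • 1 := by
  rw [map_sub, aeval_C, Algebra.algebraMap_eq_smul_one, sub_add_cancel]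

/-- Subtracting the mean from `P` does not change its degree; the centered part gives an alternating
centered word and the constant leaves `M` alone. Both have degree below `n`. -/
lemma VanishesBelow.φ_aeval_mul {n : ℕ} (hn : VanishesBelow x n) (r : Fin t) (P : ℂ[X])
    {M : List ((Fin t ⊕ Unit) × ℂ[X])} (hM : M ≠ []) (halt : IsAlternating M)
    (hcen : IsCentered x M) (hhead : ∀ y ∈ M.head?, y.1 ≠ .inl r)
    (hdeg : P.natDegree + leftDegree M < n) :
    𝒜.φ (aeval (x (.inl r)) P * polyProd x M) = 0 := by
  set c := 𝒜.φ (aeval (x (.inl r)) P) with hc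
  have h1 := hn (((.inl r, P - C c) : (Fin t ⊕ Unit) × ℂ[X]) :: M) (by simp)
    (List.isChain_cons.2 ⟨fun y hy => (hhead y hy).symm, halt⟩)
    ((isCentered_singleton x (.inl r) P).append hcen) (by
      simpa using hdeg)
  have h2 := hn M hM halt hcen (by omega)
  rw [aeval_eq_sub_C_add _ P c, add_mul, map_add, smul_mul_assoc, one_mul, map_smul, h2, smul_zero,
    add_zero]
  simpa using h1

lemma VanishesBelow.φ_aeval_mul_mul {n : ℕ} (hn : VanishesBelow x n) (r : Fin t) (P R : ℂ[X])
    {M : List ((Fin t ⊕ Unit) × ℂ[X])} (hM : M ≠ []) (halt : IsAlternating M)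
    (hcen : IsCentered x M) (hhead : ∀ y ∈ M.head?, y.1 ≠ .inl r)
    (hlast : ∀ y ∈ M.getLast?, y.1 ≠ .inl r)
    (hdeg : P.natDegree + leftDegree M + R.natDegree < n) :
    𝒜.φ (aeval (x (.inl r)) P * polyProd x M * aeval (x (.inl r)) R) = 0 := by
  set c := 𝒜.φ (aeval (x (.inl r)) R) with hc
  have h1 := hn.φ_aeval_mul r P (M := M ++ [(.inl r, R - C c)]) (by simp)
    (List.isChain_append.2 ⟨halt, List.isChain_singleton _, by simpa using hlast⟩)
    (hcen.append (isCentered_singleton x (.inl r) R))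
    (by rwa [List.head?_append_of_ne_nil _ hM]) (by
      simp
      omega)
  have h2 := hn.φ_aeval_mul r P hM halt hcen hhead (by omega)
  rw [aeval_eq_sub_C_add _ R c, mul_add, map_add, mul_smul_comm, mul_one, map_smul, h2, smul_zero,
    add_zero]
  simpa [mul_assoc] using h1

/-- Write P = X Q + const. The constant leaves the product over `W`, of smaller degree. The loop
equation turns the rest into the difference quotient of Q(x_r) W. Differentiating Q leaves factors
φ(x_r^l W); differentiating a later factor R(x_r) leaves φ(Q M x_r^l), where `M` is the part of `W`
before it. All have degree below `n` and vanish after centering at the ends. -/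
lemma φ_polyProd_eq_zero_of_left (h : SatisfiesLoopEquation x E) {n : ℕ} (hn : VanishesBelow x n)
    (r : Fin t) (P : ℂ[X]) (W : List ((Fin t ⊕ Unit) × ℂ[X]))
    (halt : IsAlternating ((.inl r, P) :: W)) (hcen : IsCentered x ((.inl r, P) :: W))
    (hdeg : P.natDegree + leftDegree W = n) : 𝒜.φ (polyProd x ((.inl r, P) :: W)) = 0 := by
  have hP := hcen (.inl r, P) (by simp)
  have hcenW : IsCentered x W := fun y hy => hcen y (by simp [hy])
  have halt' := List.isChain_cons.1 halt
  have hhead : ∀ y ∈ W.head?, y.1 ≠ .inl r := fun y hy => (halt'.1 y hy).symm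
  rw [polyProd_cons]
  simp only at hP ⊢
  rcases eq_or_ne W [] with rfl | hW
  · simpa using hP
  -- A centered constant is zero, so `P` may be taken of positive degree.
  rcases Nat.eq_zero_or_pos P.natDegree with h0 | hpos
  · rw [eq_C_of_natDegree_eq_zero h0, aeval_C, φ_algebraMap] at hP
    rw [eq_C_of_natDegree_eq_zero h0, hP]
    simp
  set Q := P.divX with hQ
  have hdQ : Q.natDegree = P.natDegree - 1 := natDegree_divX_eq_natDegree_tsub_one
  have hφW : 𝒜.φ (polyProd x W) = 0 := hn W hW halt'.2 hcenW (by omega)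
  have e1 : aeval (x (.inl r)) P =
      x (.inl r) * aeval (x (.inl r)) Q + P.coeff 0 • 1 := by
    conv_lhs => rw [← X_mul_divX_add P]
    rw [map_add, map_mul, aeval_X, aeval_C, Algebra.algebraMap_eq_smul_one]
  rw [e1, add_mul, map_add, smul_mul_assoc, one_mul, map_smul, hφW, smul_zero, add_zero, mul_assoc,
    h.loop, h.leibniz, mul_one, one_mul]
  rw [h.map_aeval_eq_zero' r _ _ Q fun l hl => ?_, zero_add]
  swap
  · have := hn.φ_aeval_mul r (X ^ l) hW halt'.2 hcenW hhead (by rw [natDegree_X_pow]; omega)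
    simpa using this
  -- The Leibniz rule passes along `W`, and `M` is the part already passed. At a factor in the
  -- variable `r`, alternation forces `M` to be nonempty and to begin and end with other variables.
  have key : ∀ L M : List ((Fin t ⊕ Unit) × ℂ[X]), M ++ L = W →
      E r (aeval (x (.inl r)) Q * polyProd x M) 1 (polyProd x L) = 0 := by
    intro L
    induction L with
    | nil => intro M _; rw [polyProd_nil, h.map_one]
    | cons y L ih =>
      intro M hML
      obtain ⟨i, R⟩ := y
      rw [polyProd_cons, h.leibniz]
      have h2 := ih (M ++ [(i, R)]) (by simpa using hML)
      rw [polyProd_append, polyProd_cons, polyProd_nil, mul_one, ← mul_assoc] at h2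
      rw [h2, add_zero]
      by_cases hi : i = .inl r
      · subst hi
        have hM : M ≠ [] := by
          rintro rfl
          exact hhead (.inl r, R) (by simp [← hML]) rfl
        rw [← hML] at halt' hhead hcenW hdeg
        have hc := List.isChain_append.1 halt'.2
        refine h.map_aeval_eq_zero r _ _ R fun l hl => ?_
        have := hn.φ_aeval_mul_mul r Q (X ^ l) hM hc.1 (fun y hy => hcenW y (by simp [hy]))
          (fun y hy => hhead y (by rwa [List.head?_append_of_ne_nil _ hM]))
          (fun y hy => hc.2.2 y hy (.inl r, R) (by simp)) (by
            simp at hdeg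
            rw [natDegree_X_pow]
            omega)
        simpa using this
      · exact h.map_aeval_other r _ _ R hi
  simpa using key W [] rfl

/-- Only letters `inl _` count for the degree, so polynomials in `inr ()` can be rotated and merged
at no cost. A product that starts with `inr ()` is thereby reduced to products of the same degree
starting with some `inl r`. -/
lemma vanishesBelow (h : SatisfiesLoopEquation x E) (n : ℕ) : VanishesBelow x n := by
  induction n with
  | zero => intro l _ _ _ hl; omega
  | succ n ih =>
    have hleft : ∀ (r : Fin t) (P : ℂ[X]) (W : List ((Fin t ⊕ Unit) × ℂ[X])),
        IsAlternating ((.inl r, P) :: W) → IsCentered x ((.inl r, P) :: W) →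
        leftDegree ((.inl r, P) :: W) < n + 1 → 𝒜.φ (polyProd x ((.inl r, P) :: W)) = 0 := by
      intro r P W halt hcen hdeg
      rcases Nat.lt_succ_iff_lt_or_eq.1 hdeg with hlt | heq
      · exact ih _ (by simp) halt hcen hlt
      · exact h.φ_polyProd_eq_zero_of_left ih r P W halt hcen (by simpa using heq)
    intro l hl halt hcen hdeg
    obtain ⟨⟨i, P⟩, W, rfl⟩ := List.exists_cons_of_ne_nil hl
    rcases i with r | u
    · exact hleft r P W halt hcen hdeg
    have hcenW : IsCentered x W := fun y hy => hcen y (by simp [hy])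
    have hP := hcen (.inr u, P) (by simp)
    rcases eq_or_ne W [] with rfl | hW
    · simpa using hP
    obtain ⟨⟨j, Q⟩, W, rfl⟩ := List.exists_cons_of_ne_nil hW
    have halt' := List.isChain_cons.1 halt
    rcases j with r | j
    swap
    · exact absurd rfl (halt'.1 (.inr j, Q) (by simp))
    have hdegW : leftDegree ((.inl r, Q) :: W) < n + 1 := by simpa using hdeg
    rw [polyProd_cons, h.cyclic]
    rcases List.eq_nil_or_concat W with rfl | ⟨V, ⟨i, R⟩, rfl⟩
    · have := hleft r Q [(.inr u, P)] (by simp [IsAlternating]) (hcenW.append fun y hy => by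
          rw [List.mem_singleton.1 hy]; exact hP) (by simpa using hdegW)
      simpa using this
    rw [List.concat_eq_append] at *
    rcases i with r' | i
    · have := hleft r Q (V ++ [(.inl r', R)] ++ [(.inr u, P)])
        (by
          have := halt'.2
          rw [← List.cons_append] at this
          rw [← List.cons_append, ← List.cons_append]
          exact List.isChain_append.2 ⟨this, List.isChain_singleton _, fun y hy z hz => by
            rw [List.getLast?_concat, Option.mem_some_iff] at hy
            rw [List.head?_cons, Option.mem_some_iff] at hz
            rw [← hy, ← hz]
            exact Sum.inl_ne_inr⟩)
        (by
          have := hcenW.append (l' := [(.inr u, P)]) fun y hy => by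
            rw [List.mem_singleton.1 hy]; exact hP
          simpa only [List.cons_append] using this) (by simpa using hdegW)
      simpa [mul_assoc] using this
    -- After the rotation `P` meets a last factor in the same variable. Centering the product `R *
    -- P` gives two alternating centered words starting with `inl r`.
    · set c := 𝒜.φ (aeval (x (.inr u)) (R * P)) with hc
      have hV : IsAlternating ((.inl r, Q) :: V) :=
        (List.isChain_append.1 (by simpa using halt'.2 : List.IsChain _ (((.inl r, Q) :: V) ++ _))).1
      have hcV : IsCentered x ((.inl r, Q) :: V) := fun y hy => hcenW y (by
        rw [List.mem_cons] at hy; rcases hy with rfl | hy <;> simp [*])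
      have h1 := hleft r Q V hV hcV (by simpa using hdegW)
      have h2 := hleft r Q (V ++ [(.inr u, R * P - C c)])
        (by
          have := List.isChain_append.1
            (by simpa using halt'.2 : List.IsChain _ (((.inl r, Q) :: V) ++ _))
          rw [← List.cons_append]
          exact List.isChain_append.2 ⟨this.1, List.isChain_singleton _, fun y hy z hz => by
            rw [List.head?_cons, Option.mem_some_iff] at hz
            rw [← hz]
            exact this.2.2 y hy (.inr i, R) (by simp)⟩)
        (by simpa only [List.cons_append] using
          hcV.append (isCentered_singleton x (.inr u) (R * P))) (by simpa using hdegW)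
      have e : polyProd x ((.inl r, Q) :: (V ++ [(.inr i, R)])) * aeval (x (.inr u)) P =
          polyProd x ((.inl r, Q) :: (V ++ [(.inr u, R * P - C c)])) +
            c • polyProd x ((.inl r, Q) :: V) := by
        simp [Algebra.algebraMap_eq_smul_one, mul_assoc, mul_sub]
      rw [e, map_add, map_smul, h1, h2, smul_zero, add_zero]

/-- The loop equation implies freeness. -/
theorem freeVariables (h : SatisfiesLoopEquation x E) : FreeVariables 𝒜 x :=
  freeVariables_iff.2 fun l hl halt hcen =>
    h.vanishesBelow (leftDegree l + 1) l hl halt hcen (Nat.lt_succ_self _)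

lemma sum_range_two_mul_add_one {M : Type*} [AddCommMonoid M] (f : ℕ → M) (n : ℕ) :
    ∑ l ∈ Finset.range (2 * n + 1), f l =
      ∑ a ∈ Finset.range (n + 1), f (2 * a) + ∑ a ∈ Finset.range n, f (2 * a + 1) := by
  induction n with
  | zero => simp
  | succ n ih =>
    rw [show 2 * (n + 1) + 1 = 2 * n + 1 + 1 + 1 by ring, Finset.sum_range_succ,
      Finset.sum_range_succ, ih, Finset.sum_range_succ _ (n + 1),
      Finset.sum_range_succ (fun a => f (2 * a + 1)) n]
    rw [show 2 * n + 1 + 1 = 2 * (n + 1) by ring]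
    abel

/-- The loop equation determines the individual distributions of the variables `x (inl r)`. -/
theorem hasStandardSemicircularLaw (h : SatisfiesLoopEquation x E) (r : Fin t) :
    HasStandardSemicircularLaw 𝒜 (x (.inl r)) := by
  set s := x (.inl r)
  -- For even order the terms with odd `l` vanish and the Catalan recursion remains; for odd order
  -- every product contains an odd moment.
  have hrec : ∀ k, 𝒜.φ (s ^ (k + 1)) =
      ∑ l ∈ Finset.range k, 𝒜.φ (s ^ l) * 𝒜.φ (s ^ (k - 1 - l)) := fun k => by
    rw [pow_succ', h.loop, h.map_pow]
    simp [s]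
  intro n
  induction n using Nat.strong_induction_on with
  | _ n ih =>
  have heven : 𝒜.φ (s ^ (2 * n)) = (catalan n : ℂ) := by
    rcases n with _ | n
    · simp [𝒜.φ_one]
    · rw [show 2 * (n + 1) = 2 * n + 1 + 1 by ring, hrec, sum_range_two_mul_add_one,
        Finset.sum_eq_zero (s := Finset.range n), add_zero, catalan_succ,
        Fin.sum_univ_eq_sum_range (fun i => catalan i * catalan (n - i)) (n + 1)]
      · push_cast
        refine Finset.sum_congr rfl fun a ha => ?_
        rw [Finset.mem_range] at ha
        rw [(ih a ha).1, ← Nat.mul_sub,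
          (ih (n - a) (by omega)).1]
      · intro a ha
        rw [Finset.mem_range] at ha
        rw [(ih a (by omega)).2, zero_mul]
  refine ⟨heven, ?_⟩
  rw [hrec]
  refine Finset.sum_eq_zero fun l hl => ?_
  rw [Finset.mem_range] at hl
  rcases Nat.even_or_odd' l with ⟨a, rfl | rfl⟩
  · rw [show 2 * n - 1 - 2 * a = 2 * (n - 1 - a) + 1 by omega, (ih (n - 1 - a) (by omega)).2,
      mul_zero]
  · rw [(ih a (by omega)).2, zero_mul]

end SatisfiesLoopEquation

end LoopFreeness

/-! ### The algebra of words -/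

section WordAlgebra

variable {α : Type*}

/-- The linear extension of a function on words. -/
noncomputable def wordLift {V : Type*} [AddCommGroup V] [Module ℂ V] (T : FreeMonoid α → V) :
    MonoidAlgebra ℂ (FreeMonoid α) →ₗ[ℂ] V :=
  (Finsupp.linearCombination ℂ T) ∘ₗ (MonoidAlgebra.coeffLinearEquiv ℂ).toLinearMap

@[simp] lemma wordLift_of {V : Type*} [AddCommGroup V] [Module ℂ V] (T : FreeMonoid α → V)
    (w : FreeMonoid α) : wordLift T (MonoidAlgebra.of ℂ (FreeMonoid α) w) = T w := by
  simp [wordLift]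

/-- The non-commutative probability space of non-commutative polynomials with the functional given
by `ℓ` on words. -/
@[reducible] noncomputable def wordSpace (ℓ : List α → ℂ) (hℓ : ℓ [] = 1) : NCProbSpace where
  carrier := MonoidAlgebra ℂ (FreeMonoid α)
  φ := wordLift fun w => ℓ w.toList
  φ_one := by
    rw [← map_one (MonoidAlgebra.of ℂ (FreeMonoid α)), wordLift_of]
    exact hℓ

/-- The letter `i` as an element of the algebra of words. -/
noncomputable def letter (i : α) : MonoidAlgebra ℂ (FreeMonoid α) :=
  MonoidAlgebra.of ℂ (FreeMonoid α) (FreeMonoid.of i)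

lemma prod_map_letter (w : List α) :
    (w.map letter).prod = MonoidAlgebra.of ℂ (FreeMonoid α) (FreeMonoid.ofList w) := by
  induction w with
  | nil => exact (map_one _).symm
  | cons x w ih =>
    rw [List.map_cons, List.prod_cons, ih, FreeMonoid.ofList_cons, map_mul]
    rfl

end WordAlgebra

/-! ### Free difference quotients on words -/

section LoopWordSpace

variable {t : ℕ} {μ : ℕ → ℂ} {ℓ : List (Fin t ⊕ Unit) → ℂ}

/-- The functionals built from the free difference quotients on words. -/
noncomputable def wordDerivative (ℓ : List (Fin t ⊕ Unit) → ℂ) (r : Fin t)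
    (a b : MonoidAlgebra ℂ (FreeMonoid (Fin t ⊕ Unit))) :
    MonoidAlgebra ℂ (FreeMonoid (Fin t ⊕ Unit)) →ₗ[ℂ] ℂ :=
  wordLift fun w => ((splits (.inl r) w.toList).map fun p =>
    wordLift (fun w => ℓ w.toList)
      (a * MonoidAlgebra.of ℂ (FreeMonoid (Fin t ⊕ Unit)) (FreeMonoid.ofList p.1)) *
    wordLift (fun w => ℓ w.toList)
      (MonoidAlgebra.of ℂ (FreeMonoid (Fin t ⊕ Unit)) (FreeMonoid.ofList p.2) * b)).sum

lemma wordDerivative_add_left (r : Fin t) (a a' b c) :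
    wordDerivative ℓ r (a + a') b c = wordDerivative ℓ r a b c + wordDerivative ℓ r a' b c := by
  induction c using MonoidAlgebra.induction_on with
  | of w => simp only [wordDerivative, wordLift_of, add_mul, map_add, List.sum_map_add]
  | add c d hc hd => rw [map_add, map_add, map_add, hc, hd]; ring
  | smul k c hc => rw [map_smul, map_smul, map_smul, hc, smul_add]

lemma wordDerivative_smul_left (r : Fin t) (k : ℂ) (a b c) :
    wordDerivative ℓ r (k • a) b c = k * wordDerivative ℓ r a b c := by
  induction c using MonoidAlgebra.induction_on with
  | of w =>
    simp only [wordDerivative, wordLift_of, smul_mul_assoc, map_smul, smul_eq_mul, mul_assoc,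
      List.sum_map_mul_left]
  | add c d hc hd => rw [map_add, map_add, hc, hd]; ring
  | smul k' c hc => rw [map_smul, map_smul, hc, smul_eq_mul, smul_eq_mul]; ring

lemma wordDerivative_add_right (r : Fin t) (a b b' c) :
    wordDerivative ℓ r a (b + b') c = wordDerivative ℓ r a b c + wordDerivative ℓ r a b' c := by
  induction c using MonoidAlgebra.induction_on with
  | of w => simp only [wordDerivative, wordLift_of, mul_add, map_add, List.sum_map_add]
  | add c d hc hd => rw [map_add, map_add, map_add, hc, hd]; ring
  | smul k c hc => rw [map_smul, map_smul, map_smul, hc, smul_add]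

lemma wordDerivative_smul_right (r : Fin t) (k : ℂ) (a b c) :
    wordDerivative ℓ r a (k • b) c = k * wordDerivative ℓ r a b c := by
  induction c using MonoidAlgebra.induction_on with
  | of w =>
    simp only [wordDerivative, wordLift_of, mul_smul_comm, map_smul, smul_eq_mul,
      mul_left_comm _ k, List.sum_map_mul_left]
  | add c d hc hd => rw [map_add, map_add, hc, hd]; ring
  | smul k' c hc => rw [map_smul, map_smul, hc, smul_eq_mul, smul_eq_mul]; ring

/-- An occurrence of the letter in a concatenation lies in one of the two words. The general case
follows by linearity, also in the parameters `a` and `b`. -/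
lemma wordDerivative_mul (r : Fin t) (a b c d) :
    wordDerivative ℓ r a b (c * d) =
      wordDerivative ℓ r a (d * b) c + wordDerivative ℓ r (a * c) b d := by
  induction c using MonoidAlgebra.induction_on with
  | of w =>
    induction d using MonoidAlgebra.induction_on with
    | of w' =>
      rw [← map_mul]
      simp only [wordDerivative, wordLift_of, FreeMonoid.toList_mul, splits_append,
        List.map_append, List.sum_append, List.map_map, Function.comp_def]
      simp only [FreeMonoid.ofList_append, FreeMonoid.ofList_toList, map_mul, mul_assoc]
    | add d d' hd hd' =>
      rw [mul_add, map_add, hd, hd', add_mul, wordDerivative_add_right, map_add]; ring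
    | smul k d hd =>
      rw [mul_smul_comm, map_smul, hd, smul_mul_assoc, wordDerivative_smul_right, map_smul,
        smul_eq_mul, smul_eq_mul]; ring
  | add c c' hc hc' =>
    rw [add_mul, map_add, hc, hc', mul_add, wordDerivative_add_left, map_add]; ring
  | smul k c hc =>
    rw [smul_mul_assoc, map_smul, hc, mul_smul_comm, wordDerivative_smul_left, map_smul,
      smul_eq_mul, smul_eq_mul]; ring

theorem IsLoopFunctional.satisfiesLoopEquation (hℓ : IsLoopFunctional μ ℓ) (h1 : ℓ [] = 1) :
    SatisfiesLoopEquation (𝒜 := wordSpace ℓ h1) letter (wordDerivative ℓ) where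
  cyclic a b := by
    change MonoidAlgebra ℂ (FreeMonoid (Fin t ⊕ Unit)) at a b
    change wordLift _ _ = wordLift _ _
    induction a using MonoidAlgebra.induction_on with
    | of w =>
      induction b using MonoidAlgebra.induction_on with
      | of w' =>
        rw [← map_mul, ← map_mul, wordLift_of, wordLift_of, FreeMonoid.toList_mul,
          FreeMonoid.toList_mul, hℓ.cyclic]
      | add b b' hb hb' => rw [mul_add, add_mul, map_add, map_add, hb, hb']
      | smul k b hb => rw [mul_smul_comm, smul_mul_assoc, map_smul, map_smul, hb]
    | add a a' ha ha' => rw [mul_add, add_mul, map_add, map_add, ha, ha']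
    | smul k a ha => rw [mul_smul_comm, smul_mul_assoc, map_smul, map_smul, ha]
  loop r a := by
    change MonoidAlgebra ℂ (FreeMonoid (Fin t ⊕ Unit)) at a
    change wordLift _ _ = _
    induction a using MonoidAlgebra.induction_on with
    | of w =>
      rw [letter, ← map_mul, wordLift_of, wordDerivative, wordLift_of, FreeMonoid.toList_mul,
        FreeMonoid.toList_of, List.singleton_append, hℓ.loop]
      simp only [one_mul, mul_one, wordLift_of, FreeMonoid.toList_ofList]
    | add a a' ha ha' => rw [mul_add, map_add, map_add, ha, ha']
    | smul k a ha => rw [mul_smul_comm, map_smul, map_smul, ha]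
  leibniz := wordDerivative_mul
  self r a b := by
    change MonoidAlgebra ℂ (FreeMonoid (Fin t ⊕ Unit)) at a b
    rw [letter, wordDerivative, wordLift_of]
    simp [splits, ← MonoidAlgebra.one_def]
  other r a b i hi := by
    rw [letter, wordDerivative, wordLift_of]
    simp [splits, hi]

end LoopWordSpace

/-! ### The involution on words and evaluation at Hermitian matrices -/

section StarWords

variable {α : Type*}

/-- The conjugate-linear involution that reverses words. -/
noncomputable def wordStar (a : MonoidAlgebra ℂ (FreeMonoid α)) : MonoidAlgebra ℂ (FreeMonoid α) :=
  wordLift (fun w => MonoidAlgebra.of ℂ (FreeMonoid α) (star w))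
    (MonoidAlgebra.mapRingHom (FreeMonoid α) (starRingEnd ℂ) a)

@[simp] lemma wordStar_of (w : FreeMonoid α) :
    wordStar (MonoidAlgebra.of ℂ (FreeMonoid α) w) =
      MonoidAlgebra.of ℂ (FreeMonoid α) (star w) := by
  have : MonoidAlgebra.mapRingHom (FreeMonoid α) (starRingEnd ℂ)
      (MonoidAlgebra.of ℂ (FreeMonoid α) w) = MonoidAlgebra.of ℂ (FreeMonoid α) w := by
    simp [MonoidAlgebra.of_apply]
  rw [wordStar, this, wordLift_of]

lemma wordStar_add (a b : MonoidAlgebra ℂ (FreeMonoid α)) :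
    wordStar (a + b) = wordStar a + wordStar b := by
  simp [wordStar]

lemma wordStar_smul (c : ℂ) (a : MonoidAlgebra ℂ (FreeMonoid α)) :
    wordStar (c • a) = star c • wordStar a := by
  have : MonoidAlgebra.mapRingHom (FreeMonoid α) (starRingEnd ℂ) (c • a) =
      star c • MonoidAlgebra.mapRingHom (FreeMonoid α) (starRingEnd ℂ) a := by
    ext w; simp
  rw [wordStar, this, map_smul, wordStar]

lemma wordStar_mul (a b : MonoidAlgebra ℂ (FreeMonoid α)) :
    wordStar (a * b) = wordStar b * wordStar a := by
  induction a using MonoidAlgebra.induction_on with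
  | of w =>
    induction b using MonoidAlgebra.induction_on with
    | of w' => simp only [← map_mul, wordStar_of, star_mul]
    | add b b' hb hb' => rw [mul_add, wordStar_add, wordStar_add, add_mul, hb, hb']
    | smul k b hb => rw [mul_smul_comm, wordStar_smul, wordStar_smul, smul_mul_assoc, hb]
  | add a a' ha ha' => rw [add_mul, wordStar_add, wordStar_add, mul_add, ha, ha']
  | smul k a ha => rw [smul_mul_assoc, wordStar_smul, wordStar_smul, mul_smul_comm, ha]

lemma wordStar_wordStar (a : MonoidAlgebra ℂ (FreeMonoid α)) : wordStar (wordStar a) = a := by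
  induction a using MonoidAlgebra.induction_on with
  | of w => rw [wordStar_of, wordStar_of, star_star]
  | add a a' ha ha' => rw [wordStar_add, wordStar_add, ha, ha']
  | smul k a ha => rw [wordStar_smul, wordStar_smul, star_star, ha]

/-- The algebra of non-commutative polynomials in self-adjoint variables is a star ring. -/
@[reducible] noncomputable def wordStarRing (α : Type*) :
    StarRing (MonoidAlgebra ℂ (FreeMonoid α)) where
  star := wordStar
  star_involutive := wordStar_wordStar
  star_mul := wordStar_mul
  star_add := wordStar_add

/-- Evaluation of non-commutative polynomials at matrices. -/
noncomputable def wordEval {N : ℕ} (A : α → Matrix (Fin N) (Fin N) ℂ) :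
    MonoidAlgebra ℂ (FreeMonoid α) →ₐ[ℂ] Matrix (Fin N) (Fin N) ℂ :=
  MonoidAlgebra.lift ℂ _ (FreeMonoid α) (FreeMonoid.lift A)

@[simp] lemma wordEval_of {N : ℕ} (A : α → Matrix (Fin N) (Fin N) ℂ) (w : FreeMonoid α) :
    wordEval A (MonoidAlgebra.of ℂ (FreeMonoid α) w) = (w.toList.map A).prod := by
  rw [wordEval, MonoidAlgebra.lift_of, FreeMonoid.lift_apply]

lemma wordEval_wordStar {N : ℕ} {A : α → Matrix (Fin N) (Fin N) ℂ}
    (hA : ∀ i, (A i).IsHermitian) (a : MonoidAlgebra ℂ (FreeMonoid α)) :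
    wordEval A (wordStar a) = (wordEval A a).conjTranspose := by
  induction a using MonoidAlgebra.induction_on with
  | of w =>
    have : ∀ l : List α, (l.reverse.map A).prod = ((l.map A).prod).conjTranspose := fun l => by
      induction l with
      | nil => simp
      | cons i l ih =>
        rw [List.reverse_cons, List.map_append, List.prod_append, ih, List.map_cons, List.map_nil,
          List.prod_singleton, List.map_cons, List.prod_cons, Matrix.conjTranspose_mul, (hA i).eq]
    rw [wordStar_of, wordEval_of, wordEval_of, ← this]
    rfl
  | add a a' ha ha' => rw [wordStar_add, map_add, map_add, Matrix.conjTranspose_add, ha, ha']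
  | smul k a ha => rw [wordStar_smul, map_smul, map_smul, Matrix.conjTranspose_smul, ha]

lemma normTrace_conjTranspose_mul_self {N : ℕ} (M : Matrix (Fin N) (Fin N) ℂ) :
    ∃ c : ℝ, 0 ≤ c ∧ normTrace (M.conjTranspose * M) = c := by
  refine ⟨(∑ i, ∑ j, ‖M j i‖ ^ 2) / N, by positivity, ?_⟩
  simp only [normTrace, Matrix.trace, Matrix.diag_apply, Matrix.mul_apply,
    Matrix.conjTranspose_apply]
  push_cast
  congr 1
  refine Finset.sum_congr rfl fun i _ => Finset.sum_congr rfl fun j _ => ?_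
  exact Complex.conj_mul' _

end StarWords

/-! ### Positivity of the limit functional -/

section Positivity

variable {α : Type*} {Ω : ℕ → Type w} [∀ N, MeasurableSpace (Ω N)]
  {P : ∀ N, Measure (Ω N)} {A : ∀ N, α → Ω N → Matrix (Fin N) (Fin N) ℂ} {ℓ : List α → ℂ}

lemma normTrace_add {N : ℕ} (M M' : Matrix (Fin N) (Fin N) ℂ) :
    normTrace (M + M') = normTrace M + normTrace M' := by
  simp [normTrace, add_div]

lemma normTrace_smul {N : ℕ} (c : ℂ) (M : Matrix (Fin N) (Fin N) ℂ) :
    normTrace (c • M) = c * normTrace M := by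
  simp [normTrace, mul_div_assoc]

lemma tendsto_integral_normTrace_wordEval
    (hint : ∀ w : List α, ∀ N, 1 ≤ N →
      Integrable (fun ω => normTrace (w.map fun i => A N i ω).prod) (P N))
    (hlim : ∀ w : List α, Tendsto (fun N => ∫ ω, normTrace (w.map fun i => A N i ω).prod ∂(P N))
      atTop (𝓝 (ℓ w))) (a : MonoidAlgebra ℂ (FreeMonoid α)) :
    (∀ N, 1 ≤ N → Integrable (fun ω => normTrace (wordEval (fun i => A N i ω) a)) (P N)) ∧
    Tendsto (fun N => ∫ ω, normTrace (wordEval (fun i => A N i ω) a) ∂(P N)) atTop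
      (𝓝 (wordLift (fun w => ℓ w.toList) a)) := by
  induction a using MonoidAlgebra.induction_on with
  | of w =>
    simp only [wordEval_of, wordLift_of]
    exact ⟨hint _, hlim _⟩
  | add a b ha hb =>
    simp only [map_add, normTrace_add]
    refine ⟨fun N hN => (ha.1 N hN).add (hb.1 N hN), (ha.2.add hb.2).congr' ?_⟩
    filter_upwards [eventually_ge_atTop 1] with N hN
    exact (integral_add (ha.1 N hN) (hb.1 N hN)).symm
  | smul k a ha =>
    simp only [map_smul, normTrace_smul, integral_const_mul, smul_eq_mul]
    exact ⟨fun N hN => (ha.1 N hN).const_mul k, ha.2.const_mul k⟩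

/-- At Hermitian matrices `wordStar a * a` evaluates to M* M, whose normalized trace is real and
nonnegative. Both properties survive the expectation and the limit. -/
lemma wordLift_star_mul_self_nonneg
    (hint : ∀ w : List α, ∀ N, 1 ≤ N →
      Integrable (fun ω => normTrace (w.map fun i => A N i ω).prod) (P N))
    (hlim : ∀ w : List α, Tendsto (fun N => ∫ ω, normTrace (w.map fun i => A N i ω).prod ∂(P N))
      atTop (𝓝 (ℓ w)))
    (hsa : ∀ N, 1 ≤ N → ∀ᵐ ω ∂(P N), ∀ i, (A N i ω).IsHermitian)
    (a : MonoidAlgebra ℂ (FreeMonoid α)) :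
    0 ≤ (wordLift (fun w => ℓ w.toList) (wordStar a * a)).re ∧
      (wordLift (fun w => ℓ w.toList) (wordStar a * a)).im = 0 := by
  have h := (tendsto_integral_normTrace_wordEval hint hlim (wordStar a * a)).2
  have hreal : ∀ N, 1 ≤ N → ∃ c : ℝ, 0 ≤ c ∧
      ∫ ω, normTrace (wordEval (fun i => A N i ω) (wordStar a * a)) ∂(P N) = c := by
    intro N hN
    choose g hg0 hg using fun M : Matrix (Fin N) (Fin N) ℂ => normTrace_conjTranspose_mul_self M
    refine ⟨∫ ω, g (wordEval (fun i => A N i ω) a) ∂(P N), integral_nonneg fun ω => hg0 _, ?_⟩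
    rw [← integral_complex_ofReal]
    refine integral_congr_ae ?_
    filter_upwards [hsa N hN] with ω hω
    rw [map_mul, wordEval_wordStar hω, hg]
  constructor
  · refine ge_of_tendsto ((Complex.continuous_re.tendsto _).comp h) ?_
    filter_upwards [eventually_ge_atTop 1] with N hN
    obtain ⟨c, hc, e⟩ := hreal N hN
    simp only [Function.comp]
    rw [e]
    simpa using hc
  · refine tendsto_nhds_unique ((Complex.continuous_im.tendsto _).comp h)
      (tendsto_const_nhds.congr' ?_)
    filter_upwards [eventually_ge_atTop 1] with N hN
    obtain ⟨c, hc, e⟩ := hreal N hN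
    simp only [Function.comp]
    rw [e]
    simp

end Positivity

/-! ### The limit in distribution -/

/-- Freeness is pulled back along a homomorphism preserving the functionals. Thus freeness of the
semicirculars in their own `*`-space follows from freeness in the larger space. -/
lemma FreeVariables.of_algHom {𝒜 : NCProbSpace.{u}} {ℬ : NCProbSpace.{v}} {ι κ : Type*} {x : ι → 𝒜}
    {y : κ → ℬ} (f : 𝒜 →ₐ[ℂ] ℬ) (hf : ∀ a, ℬ.φ (f a) = 𝒜.φ a) (g : ι → κ)
    (hg : Function.Injective g) (hxy : ∀ i, f (x i) = y (g i)) (hy : FreeVariables ℬ y) :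
    FreeVariables 𝒜 x := by
  intro k hk i a ha hi h0
  rw [← hf, map_list_prod, List.map_ofFn]
  refine hy k hk (g ∘ i) (f ∘ a) (fun j => ?_) (fun j j' h e => hi j j' h (hg e))
    fun j => (hf _).trans (h0 j)
  have : f (a j) ∈ (Algebra.adjoin ℂ {x (i j)}).map f := Subalgebra.mem_map.2 ⟨a j, ha j, rfl⟩
  rw [AlgHom.map_adjoin_singleton, hxy] at this
  exact this

section Limit

variable {t : ℕ} {Ω : ℕ → Type w} [∀ N, MeasurableSpace (Ω N)]

lemma sumElim_apply_eq {N : ℕ} {Ω' : Type*} (A : Fin t → Ω' → Matrix (Fin N) (Fin N) ℂ)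
    (D : Matrix (Fin N) (Fin N) ℂ) (ω : Ω') :
    (fun i : Fin t ⊕ Unit => (Sum.elim A fun _ _ => D : _ → Ω' → Matrix (Fin N) (Fin N) ℂ) i ω) =
      Sum.elim (fun r => A r ω) fun _ => D := by
  funext i
  cases i <;> rfl

/-- The space of non-commutative polynomials in the limit of the random matrices. -/
@[reducible] noncomputable def limitStarSpace (P : ∀ N, Measure (Ω N))
    (A : ∀ N, Fin t → Ω N → Matrix (Fin N) (Fin N) ℂ) (ℓ : List (Fin t) → ℂ) (h1 : ℓ [] = 1)
    (hint : ∀ w : List (Fin t), ∀ N, 1 ≤ N →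
      Integrable (fun ω => normTrace (w.map fun i => A N i ω).prod) (P N))
    (hlim : ∀ w : List (Fin t),
      Tendsto (fun N => ∫ ω, normTrace (w.map fun i => A N i ω).prod ∂(P N)) atTop (𝓝 (ℓ w)))
    (hsa : ∀ N, 1 ≤ N → ∀ᵐ ω ∂(P N), ∀ i, (A N i ω).IsHermitian) : StarProbSpace.{0} where
  toNCProbSpace := wordSpace ℓ h1
  starRing := wordStarRing (Fin t)
  starModule := @StarModule.mk _ _ _ (wordStarRing (Fin t)).toStar _ wordStar_smul
  φ_nonneg := wordLift_star_mul_self_nonneg hint hlim hsa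

end Limit

/-- Both limit spaces are word algebras with the functional given by `ℓ`: words in the Gaussian
letters for `𝒞`, all words for `ℬ`. Only `𝒞` carries an involution, since `D N` need not be
Hermitian; hence two spaces linked by `f`. -/
theorem mainTheorem9 {t : ℕ} {Ω : ℕ → Type w} [∀ N, MeasurableSpace (Ω N)]
    (P : ∀ N, Measure (Ω N)) [∀ N, IsProbabilityMeasure (P N)]
    (A : ∀ N, Fin t → Ω N → Matrix (Fin N) (Fin N) ℂ)
    (hA : ∀ N, 1 ≤ N → IsIndepGUE (P N) (A N))
    (D : ∀ N, Matrix (Fin N) (Fin N) ℂ)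
    (𝒜 : NCProbSpace.{u}) (d : 𝒜)
    (hD : ∀ k : ℕ, 1 ≤ k → Tendsto (fun N => normTrace (D N ^ k)) atTop (𝓝 (𝒜.φ (d ^ k)))) :
    -- the limit of the mixed moments
    (∀ (m : ℕ) (q : Fin m → ℕ) (p : Fin m → Fin t),
      (∀ N, 1 ≤ N → Integrable (fun ω =>
        normTrace (List.ofFn fun j => A N (p j) ω * D N ^ q j).prod) (P N)) ∧
      Tendsto (fun N => ∫ ω, normTrace (List.ofFn fun j => A N (p j) ω * D N ^ q j).prod ∂(P N))
        atTop
        (𝓝 (∑ π ∈ nonCrossingPairings p,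
          momentAlong 𝒜 (π * finRotate m) fun j => d ^ q j)) ∧
      (∀ π ∈ nonCrossingPairings p,
        IsKrewerasComplement (orbitPartition π) (orbitPartition (π * finRotate m)))) ∧
    -- there are free standard semicirculars, free from a copy of `d`, as limits in distribution
    (∃ (𝒞 : StarProbSpace.{0}) (c : Fin t → 𝒞.carrier),
      (∀ r, IsStandardSemicircular 𝒞 (c r)) ∧
      FreeVariables 𝒞.toNCProbSpace c ∧
      ConvergesInDistribution P A 𝒞.toNCProbSpace c ∧
      ∃ (ℬ : NCProbSpace.{0}) (f : 𝒞.carrier →ₐ[ℂ] ℬ) (d' : ℬ),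
        (∀ x, ℬ.φ (f x) = 𝒞.φ x) ∧
        (∀ k : ℕ, ℬ.φ (d' ^ k) = 𝒜.φ (d ^ k)) ∧
        FreeVariables ℬ (Sum.elim (fun r => f (c r)) fun _ : Unit => d') ∧
        ConvergesInDistribution P (fun N => Sum.elim (A N) fun _ _ => D N) ℬ
          (Sum.elim (fun r => f (c r)) fun _ : Unit => d')) ∧
    -- and every realization of such variables, in any space, is the limit
    (∀ (ℬ : NCProbSpace.{v}) (s : Fin t → ℬ),
      (∀ r, HasStandardSemicircularLaw ℬ (s r)) →
      (FreeVariables ℬ s → ConvergesInDistribution P A ℬ s) ∧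
      (∀ d' : ℬ, (∀ k : ℕ, ℬ.φ (d' ^ k) = 𝒜.φ (d ^ k)) →
        FreeVariables ℬ (Sum.elim s fun _ : Unit => d') →
        ConvergesInDistribution P (fun N => Sum.elim (A N) fun _ _ => D N) ℬ
          (Sum.elim s fun _ : Unit => d'))) := by
  set μ : ℕ → ℂ := fun k => 𝒜.φ (d ^ k) with hμdef
  have hμ : ∀ k, Tendsto (fun N => normTrace (D N ^ k)) atTop (𝓝 (μ k)) := by
    intro k
    rcases Nat.eq_zero_or_pos k with rfl | hk
    -- The moment of order zero is not part of the assumption; it equals 1 for `N ≥ 1`, while for `N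
    -- = 0` the normalized trace is 0.
    · refine tendsto_const_nhds.congr' ?_
      filter_upwards [eventually_ge_atTop 1] with N hN
      rw [pow_zero, normTrace_one hN]
      simp only [hμdef, pow_zero, 𝒜.φ_one]
    · exact hD k hk
  obtain ⟨ℓ, hℓ, hT⟩ := exists_tendsto_traceMoment (P := P) hA hμ
  have h1 : ℓ [] = 1 := by
    have := hℓ.moments 0
    rw [List.replicate_zero] at this
    rw [this]
    simp only [hμdef, pow_zero, 𝒜.φ_one]
  have hint : ∀ (w : List (Fin t ⊕ Unit)) (N : ℕ), 1 ≤ N → Integrable (fun ω =>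
      normTrace (w.map (Sum.elim (fun r => A N r ω) fun _ => D N)).prod) (P N) :=
    fun w N hN => (hA N hN).integrable_normTrace (D N) w
  have hlim : ∀ w : List (Fin t ⊕ Unit), Tendsto (fun N => ∫ ω,
      normTrace (w.map (Sum.elim (fun r => A N r ω) fun _ => D N)).prod ∂(P N)) atTop
      (𝓝 (ℓ w)) := fun w => by
    simpa [traceMoment] using hT [w]
  have hmap : ∀ (w : List (Fin t)) (N : ℕ) (ω : Ω N),
      (w.map .inl).map (Sum.elim (fun r => A N r ω) fun _ : Unit => D N) =
        w.map fun r => A N r ω := fun w N ω => by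
    rw [List.map_map]
    rfl
  have hintA : ∀ w : List (Fin t), ∀ N, 1 ≤ N →
      Integrable (fun ω => normTrace (w.map fun i => A N i ω).prod) (P N) := fun w N hN => by
    have := hint (w.map .inl) N hN
    simpa only [hmap] using this
  have hlimA : ∀ w : List (Fin t),
      Tendsto (fun N => ∫ ω, normTrace (w.map fun i => A N i ω).prod ∂(P N)) atTop
        (𝓝 (ℓ (w.map .inl))) := fun w => by
    have := hlim (w.map .inl)
    simpa only [hmap] using this
  have hsa : ∀ N, 1 ≤ N → ∀ᵐ ω ∂(P N), ∀ i, (A N i ω).IsHermitian := fun N hN =>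
    ae_all_iff.2 fun r => ((hA N hN).gue r).selfAdjoint
  have hB := hℓ.satisfiesLoopEquation h1
  have hBfree := hB.freeVariables
  set 𝒞 : StarProbSpace.{0} :=
    limitStarSpace P A (fun w => ℓ (w.map .inl)) h1 hintA hlimA hsa
  set f : MonoidAlgebra ℂ (FreeMonoid (Fin t)) →ₐ[ℂ] MonoidAlgebra ℂ (FreeMonoid (Fin t ⊕ Unit)) :=
    MonoidAlgebra.mapDomainAlgHom ℂ ℂ (FreeMonoid.map Sum.inl)
  have f_of : ∀ w, f (MonoidAlgebra.of ℂ _ w) = MonoidAlgebra.of ℂ _ (FreeMonoid.map Sum.inl w) :=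
    fun w => by simp [f]
  have hφf : ∀ x, (wordSpace ℓ h1).φ (f x) = 𝒞.φ x := by
    intro x
    change wordLift _ (f x) = wordLift _ x
    induction x using MonoidAlgebra.induction_on with
    | of w => rw [f_of, wordLift_of, wordLift_of, FreeMonoid.toList_map]
    | add a b ha hb => rw [map_add, map_add, map_add, ha, hb]
    | smul k a ha => rw [map_smul, map_smul, map_smul, ha]
  have f_letter : ∀ r, f (letter r) = letter (Sum.inl r) := fun r => f_of _
  have hfree𝒞 : FreeVariables 𝒞.toNCProbSpace (letter : Fin t → MonoidAlgebra ℂ _) :=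
    hBfree.of_algHom f hφf Sum.inl Sum.inl_injective f_letter
  have hlaw𝒞 : ∀ r : Fin t, HasStandardSemicircularLaw 𝒞.toNCProbSpace (letter r) := fun r n => by
    have := hB.hasStandardSemicircularLaw r n
    rw [← f_letter, ← map_pow f, ← map_pow f, hφf, hφf] at this
    exact this
  have hpow : ∀ k : ℕ, (wordSpace ℓ h1).φ (letter (.inr ()) ^ k) = 𝒜.φ (d ^ k) := fun k => by
    change _ = μ k
    rw [← hℓ.moments k, ← List.prod_replicate, ← List.map_replicate, prod_map_letter]
    exact wordLift_of _ _
  have hconvA : ConvergesInDistribution P A 𝒞.toNCProbSpace letter := fun w => by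
    refine ⟨hintA w, ?_⟩
    rw [prod_map_letter]
    change Tendsto _ _ (𝓝 (wordLift _ _))
    rw [wordLift_of]
    exact hlimA w
  have hconvB : ConvergesInDistribution P (fun N => Sum.elim (A N) fun _ _ => D N)
      (wordSpace ℓ h1) letter := fun w => by
    simp only [sumElim_apply_eq]
    refine ⟨hint w, ?_⟩
    rw [prod_map_letter]
    change Tendsto _ _ (𝓝 (wordLift _ _))
    rw [wordLift_of]
    exact hlim w
  have helim : (Sum.elim (fun r => f (letter r)) fun _ : Unit => letter (.inr ())) = letter := by
    funext i
    cases i with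
    | inl r => exact f_letter r
    | inr _ => rfl
  refine ⟨fun m q p => ?_, ⟨𝒞, letter, fun r => ⟨?_, hlaw𝒞 r⟩, hfree𝒞, hconvA, wordSpace ℓ h1, f,
    letter (.inr ()), hφf, hpow, ?_, ?_⟩, fun ℬ s hs => ⟨fun hsfree w => ?_, fun d' hd' hsd w => ?_⟩⟩
  -- The colours are extended to all naturals; the default letter beyond `m` is never read. The word
  -- starts with a Gaussian letter, whence exponent 0 in gap 0.
  · obtain ⟨c, hc⟩ : ∃ c : ℕ → Fin t ⊕ Unit, ∀ x : Fin m, c x = .inl (p x) :=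
      ⟨fun x => if h : x < m then .inl (p ⟨x, h⟩) else .inr (), fun x => by simp⟩
    have hword : ∀ (N : ℕ) (ω : Ω N), (List.ofFn fun j => A N (p j) ω * D N ^ q j).prod =
        ((gapWord c (gapExponent q) 0 m).map
          (Sum.elim (fun r => A N r ω) fun _ => D N)).prod := fun N ω => by
      rw [prod_map_gapWord]
      simp only [zero_add, hc, Sum.elim_inl, Sum.elim_inr, gapExponent_succ]
      rw [show gapExponent q 0 = 0 from rfl, pow_zero, one_mul]
    simp only [hword]
    refine ⟨hint _, ?_, fun π hπ => ?_⟩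
    · rw [nonCrossingPairings_eq, Finset.sum_congr rfl fun π hπ =>
        momentAlong_eq_gapWeight 𝒜 d (mem_ncPairingsOn.1 hπ) q,
        hℓ.sum_gapWeight p c hc m 0 m _ (zero_add m) le_rfl]
      exact hlim _
    · rw [nonCrossingPairings_eq] at hπ
      exact (mem_ncPairingsOn.1 hπ).isKrewerasComplement
  · exact wordStar_of _
  · rw [helim]
    exact hBfree
  · rw [helim]
    exact hconvB
  · refine ⟨hintA w, ?_⟩
    rw [hsfree.φ_word_eq hfree𝒞 fun r k => (hs r).moments_eq (hlaw𝒞 r) k]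
    exact (hconvA w).2
  · refine ⟨(hconvB w).1, ?_⟩
    rw [hsd.φ_word_eq hBfree fun i k => ?_]
    · exact (hconvB w).2
    · cases i with
      | inl r => exact (hs r).moments_eq (hB.hasStandardSemicircularLaw r) k
      | inr _ => exact (hd' k).trans (hpow k).symm
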